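/- Let $p\ge 1$ and $q\ge 0$ be integers. Let $P(\mathbb R^q)$ be the space with coordinates $u^\alpha_{\mathbf J}$, $1\le\alpha\le q$, $\mathbf J\in\mathbb Z^p$ (write $u^\alpha=u^\alpha_{\mathbf 0}$). For $k,l\ge 0$ let $\Omega^{k,l}$ be the real vector space of $(k,l)$-forms on $\mathbb Z^p\times P(\mathbb R^q)$, i.e. of the finite sums $$\sigma=\sum f^{\mathbf J_1,\dots,\mathbf J_l}_{i_1,\dots,i_k;\alpha_1,\dots,\alpha_l}(\mathbf n,[\mathbf u])\,\Delta^{i_1}\wedge\cdots\wedge\Delta^{i_k}\wedge \mathrm d_{\mathrm v}u^{\alpha_1}_{\mathbf J_1}\wedge\cdots\wedge \mathrm d_{\mathrm v}u^{\alpha_l}_{\mathbf J_l}$$ in the exterior algebra on the symbols $\Delta^1,\dots,\Delta^p$ and $\mathrm d_{\mathrm v}u^\alpha_{\mathbf J}$, where $\mathbf n\in\mathbb Z^p$ and, for each $\sigma$, $[\mathbf u]$ is a finite set of the coordinates $u^\alpha_{\mathbf J}$, not depending on $\mathbf n$; the coefficients depend on $\mathbf n$ arbitrarily and on $[\mathbf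 u]$ smoothly. The shift $\mathrm S_{\mathbf K}$, $\mathbf K\in\mathbb Z^p$, replaces coefficients $f(\mathbf n,(u^\alpha_{\mathbf J}))$ by $f(\mathbf n+\mathbf K,(u^\alpha_{\mathbf J+\mathbf K}))$, replaces $\mathrm d_{\mathrm v}u^\alpha_{\mathbf J}$ by $\mathrm d_{\mathrm v}u^\alpha_{\mathbf J+\mathbf K}$, and fixes each $\Delta^i$. With $\mathbf 1_i$ the $i$-th unit vector and derivatives and shifts of forms as indicated, put $$\mathrm d_{\mathrm h}^{\Delta}\sigma=\sum_i\Delta^i\wedge(\mathrm S_{\mathbf 1_i}-\mathrm{id})\sigma,\qquad \mathrm d_{\mathrm v}\sigma=\sum_{\alpha,\mathbf J}\mathrm d_{\mathrm v}u^\alpha_{\mathbf J}\wedge\frac{\partial\sigma}{\partial u^\alpha_{\mathbf J}}$$ (the partial derivative acting on coefficients), and for $l\ge1$, $\sigma\in\Omega^{p,l}$, $$\mathcal I^{\Delta}(\sigma)=\frac1l\sum_{\alpha,\mathbf J}\mathrm d_{\mathrm v}u^\alpha\wedge \mathrm S_{-\mathbf J}\Big(\frac{\partial}{\partial u^\alpha_{\mathbf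 J}}\lrcorner\,\sigma\Big),\qquad \mathscr F^l=\mathcal I^{\Delta}(\Omega^{p,l}).$$ Let $\mathcal E^{\Delta}=\mathcal I^{\Delta}\mathrm d_{\mathrm v}:\Omega^{p,0}\to\mathscr F^1$ and $\delta_{\mathrm v}^{\Delta}=\mathcal I^{\Delta}\mathrm d_{\mathrm v}:\mathscr F^l\to\mathscr F^{l+1}$ ($l\ge1$). Let $\mathbf v=\sum_{\alpha,\mathbf J}u^\alpha_{\mathbf J}\,\partial/\partial u^\alpha_{\mathbf J}$, let $$h_{\mathrm v}(\sigma)=\int_0^1\frac1\lambda\,\exp(\ln\lambda\,\mathbf v)^{*}(\mathbf v\lrcorner\sigma)\,\mathrm d\lambda:\ \Omega^{p,l}\to\Omega^{p,l-1}\quad(l\ge1),$$ where $\exp(\ln\lambda\,\mathbf v)(\mathbf n,u)=(\mathbf n,\lambda u)$, and let $\mathcal H^l=\mathcal I^{\Delta}\circ h_{\mathrm v}:\mathscr F^l\to\mathscr F^{l-1}$ for $l\ge2$. Then the difference variational complex $$0\to\mathbb R\to\Omega^{0,0}\xrightarrow{\mathrm d_{\mathrm h}^{\Delta}}\Omega^{1,0}\xrightarrow{\mathrm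 d_{\mathrm h}^{\Delta}}\cdots\xrightarrow{\mathrm d_{\mathrm h}^{\Delta}}\Omega^{p,0}\xrightarrow{\mathcal E^{\Delta}}\mathscr F^1\xrightarrow{\delta_{\mathrm v}^{\Delta}}\mathscr F^2\xrightarrow{\delta_{\mathrm v}^{\Delta}}\cdots,$$ in which $\mathbb R\to\Omega^{0,0}$ is the inclusion of the constants, is an exact sequence of real vector spaces. In particular $\sigma\in\mathscr F^1$ is of the form $\mathcal E^{\Delta}(\mathscr L)$ with $\mathscr L\in\Omega^{p,0}$ if and only if it satisfies the difference Helmholtz conditions $\delta_{\mathrm v}^{\Delta}\sigma=0$. Moreover, $$\sigma=\mathcal E^{\Delta}(h_{\mathrm v}(\sigma))+\mathcal H^{2}(\delta_{\mathrm v}^{\Delta}\sigma)\quad(\sigma\in\mathscr F^1),\qquad \sigma=\delta_{\mathrm v}^{\Delta}(\mathcal H^l(\sigma))+\mathcal H^{l+1}(\delta_{\mathrm v}^{\Delta}\sigma)\quad(\sigma\in\mathscr F^l,\ l\ge2).$$ -/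

import Mathlib

open scoped ContDiff

noncomputable section

namespace DVB

/-- Labels `(α, J)` of the coordinates `u^α_J` of the total prolongation space `P(ℝ^q)` over `ℤ^p`. -/
abbrev Coord (p q : ℕ) : Type := Fin q × (Fin p → ℤ)

/-- A point of the total prolongation space `P(ℝ^q)`: a value for every coordinate `u^α_J`. -/
abbrev Prol (p q : ℕ) : Type := Coord p q → ℝ

/-- The generators of the exterior algebra of forms on `ℤ^p × P(ℝ^q)`: the symbols `Δ^i` and the
one-forms `d_v u^α_J`. -/
inductive Gen (p q : ℕ) : Type
  | delta (i : Fin p) : Gen p q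
  | du (c : Coord p q) : Gen p q

/-- The order in which generators are written in a monomial: first the `Δ^i` by increasing `i`, then
the `d_v u^α_J` by increasing `α` and, for equal `α`, lexicographically in `J`. -/
def Gen.key {p q : ℕ} : Gen p q → Fin p ⊕ₗ (Fin q ×ₗ Lex (Fin p → ℤ))
  | .delta i => Sum.inlₗ i
  | .du c => Sum.inrₗ (toLex (c.1, toLex c.2))

theorem Gen.key_injective {p q : ℕ} : Function.Injective (Gen.key (p := p) (q := q)) := by
  rintro (i | ⟨a, J⟩) (j | ⟨b, K⟩) h <;> simp [Gen.key] at h ⊢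
  · exact h
  · exact ⟨h.1, h.2⟩

instance {p q : ℕ} : LinearOrder (Gen p q) := LinearOrder.lift' Gen.key Gen.key_injective

/-- The translation `Δ^i ↦ Δ^i`, `d_v u^α_J ↦ d_v u^α_{J+K}` of generators. -/
def Gen.translate {p q : ℕ} (K : Fin p → ℤ) : Gen p q → Gen p q
  | .delta i => .delta i
  | .du c => .du (c.1, c.2 + K)

/-- Translations preserve the order of the generators, so they map increasing monomials to
increasing monomials, without a sign. -/
theorem Gen.translate_strictMono {p q : ℕ} (K : Fin p → ℤ) :
    StrictMono (Gen.translate (q := q) K) := by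
  rintro (i | ⟨a, J⟩) (j | ⟨b, J'⟩) h
  · exact h
  · exact Sum.Lex.inl_lt_inr _ _
  · exact absurd h (not_lt_of_gt (Sum.Lex.inl_lt_inr _ _))
  · have h' := Sum.Lex.inr_lt_inr_iff.1 h
    refine Sum.Lex.inr_lt_inr_iff.2 ?_
    rw [Prod.Lex.toLex_lt_toLex] at h' ⊢
    rcases h' with h' | ⟨h1, h2⟩
    · exact Or.inl h'
    · exact Or.inr ⟨h1, add_lt_add_left h2 (toLex K)⟩

/-- Formal forms on `ℤ^p × P(ℝ^q)`, in terms of coefficients. For a finite set `T` of generators,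
`σ T n u` is the coefficient at the point `(n, u)` of the monomial
`g₁ ∧ ⋯ ∧ g_r`, where `T = {g₁ < ⋯ < g_r}`. -/
abbrev PreForm (p q : ℕ) : Type := Finset (Gen p q) → (Fin p → ℤ) → Prol p q → ℝ

/-- Whether a generator is one of the `Δ^i`. -/
def Gen.isDelta {p q : ℕ} : Gen p q → Bool
  | .delta _ => true
  | .du _ => false

/-- The number of factors `Δ^i` in the monomial `T`. -/
def hdeg {p q : ℕ} (T : Finset (Gen p q)) : ℕ := (T.filter fun g => g.isDelta = true).card

/-- The number of factors `d_v u^α_J` in the monomial `T`. -/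
def vdeg {p q : ℕ} (T : Finset (Gen p q)) : ℕ := (T.filter fun g => g.isDelta = false).card

/-- `f` is a smooth function of the finitely many coordinates `u^α_J`, `(α, J) ∈ B`. -/
def SmoothIn {p q : ℕ} (B : Finset (Coord p q)) (f : Prol p q → ℝ) : Prop :=
  ∃ g : (B → ℝ) → ℝ, ContDiff ℝ ∞ g ∧ ∀ u, f u = g (fun b => u b)

/-- Only finitely many coordinates `[u] = (u^α_J)_{(α, J) ∈ B}` and their differentials occur in `σ`,
and all coefficients are smooth in them. -/
def IsLocal {p q : ℕ} (B : Finset (Coord p q)) (σ : PreForm p q) : Prop :=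
  (∀ T, (∃ c, c ∉ B ∧ Gen.du c ∈ T) → σ T = 0) ∧ ∀ T n, SmoothIn B (σ T n)

theorem SmoothIn.mono {p q : ℕ} {B C : Finset (Coord p q)} (h : B ⊆ C) {f : Prol p q → ℝ}
    (hf : SmoothIn B f) : SmoothIn C f := by
  obtain ⟨g, hg, hfg⟩ := hf
  refine ⟨fun v => g (fun b => v ⟨b, h b.2⟩), hg.comp ?_, fun u => hfg u⟩
  exact contDiff_pi.2 fun b => contDiff_apply ℝ ℝ _

theorem SmoothIn.zero {p q : ℕ} {B : Finset (Coord p q)} : SmoothIn B (fun _ => 0) :=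
  ⟨fun _ => 0, contDiff_const, fun _ => rfl⟩

theorem IsLocal.mono {p q : ℕ} {B C : Finset (Coord p q)} (h : B ⊆ C) {σ : PreForm p q}
    (hσ : IsLocal B σ) : IsLocal C σ :=
  ⟨fun T ⟨c, hc, hT⟩ => hσ.1 T ⟨c, fun hB => hc (h hB), hT⟩, fun T n => (hσ.2 T n).mono h⟩

/-- `Ω^{k,l}`: the real vector space of `(k,l)`-forms on `ℤ^p × P(ℝ^q)`. -/
def Forms (p q k l : ℕ) : Submodule ℝ (PreForm p q) where
  carrier := {σ | (∀ T, σ T ≠ 0 → hdeg T = k ∧ vdeg T = l) ∧ ∃ B, IsLocal B σ}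
  zero_mem' := ⟨fun T h => absurd rfl h, ∅, fun _ _ => rfl, fun _ _ => SmoothIn.zero⟩
  add_mem' := by
    rintro σ τ ⟨h1, B, hB⟩ ⟨h2, C, hC⟩
    refine ⟨fun T hT => ?_, B ∪ C, fun T h => ?_, fun T n => ?_⟩
    · by_cases h : σ T = 0
      · exact h2 T fun h' => hT (by simp [h, h'])
      · exact h1 T h
    · simp [(hB.mono Finset.subset_union_left).1 T h, (hC.mono Finset.subset_union_right).1 T h]
    · obtain ⟨f, hf, hf'⟩ := (hB.mono (Finset.subset_union_left (s₂ := C))).2 T n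
      obtain ⟨g, hg, hg'⟩ := (hC.mono (Finset.subset_union_right (s₁ := B))).2 T n
      exact ⟨fun v => f v + g v, hf.add hg, fun u => by simp [hf', hg']⟩
  smul_mem' := by
    rintro a σ ⟨h1, B, hB⟩
    refine ⟨fun T hT => h1 T fun h => hT (by simp [h]), B, fun T h => by simp [hB.1 T h],
      fun T n => ?_⟩
    obtain ⟨f, hf, hf'⟩ := hB.2 T n
    exact ⟨fun v => a * f v, contDiff_const.mul hf, fun u => by simp [hf']⟩

/-- The sign picked up when `g` is moved past the factors of the monomial `T` that precede it. -/
def sgn {p q : ℕ} (g : Gen p q) (T : Finset (Gen p q)) : ℝ := (-1) ^ (T.filter (· < g)).card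

/-- The exterior product `g ∧ σ` with a generator `g`. -/
def wedge {p q : ℕ} (g : Gen p q) (σ : PreForm p q) : PreForm p q := fun T n u =>
  if g ∈ T then sgn g T * σ (T.erase g) n u else 0

/-- The interior product `g* ⌟ σ`, where `g*` is the dual of the generator `g`; so
`contract (Gen.du (α, J)) σ` is `∂/∂u^α_J ⌟ σ`. -/
def contract {p q : ℕ} (g : Gen p q) (σ : PreForm p q) : PreForm p q := fun T n u =>
  if g ∈ T then 0 else sgn g T * σ (insert g T) n u

/-- The shift `S_K`: coefficients `f(n, (u_J))` become `f(n + K, (u_{J+K}))`, `Δ^i` is invariant and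
`d_v u^α_J` becomes `d_v u^α_{J+K}`. -/
def shift {p q : ℕ} (K : Fin p → ℤ) (σ : PreForm p q) : PreForm p q := fun T n u =>
  σ (T.image (Gen.translate (-K))) (n + K) (fun c => u (c.1, c.2 + K))

/-- The forward difference `D_{n^i} = S_i - id`. -/
def diff {p q : ℕ} (i : Fin p) (σ : PreForm p q) : PreForm p q := shift (Pi.single i 1) σ - σ

/-- The partial derivative `∂/∂u^α_J`, `c = (α, J)`, of all coefficients. -/
def pd {p q : ℕ} (c : Coord p q) (σ : PreForm p q) : PreForm p q := fun T n u =>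
  deriv (fun t => σ T n (Function.update u c t)) (u c)

/-- `d_h^Δ σ = ∑_i Δ^i ∧ D_{n^i} σ`. -/
def extDiff {p q : ℕ} (σ : PreForm p q) : PreForm p q :=
  ∑ i : Fin p, wedge (Gen.delta i) (diff i σ)

/-- `d_v σ = ∑_{α,J} d_v u^α_J ∧ ∂σ/∂u^α_J`. -/
def vertDeriv {p q : ℕ} (σ : PreForm p q) : PreForm p q := fun T n u =>
  ∑ᶠ c : Coord p q, wedge (Gen.du c) (pd c σ) T n u

/-- `I^Δ σ = (1/l) ∑_{α,J} d_v u^α ∧ S_{-J} (∂/∂u^α_J ⌟ σ)`. -/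
def interiorEuler {p q : ℕ} (l : ℕ) (σ : PreForm p q) : PreForm p q := fun T n u =>
  (1 / (l : ℝ)) * ∑ᶠ c : Coord p q,
    wedge (Gen.du (c.1, 0)) (shift (-c.2) (contract (Gen.du c) σ)) T n u

/-- `v ⌟ σ` for the prolonged radial field `v = ∑_{α,J} u^α_J ∂/∂u^α_J`. -/
def radialContract {p q : ℕ} (σ : PreForm p q) : PreForm p q := fun T n u =>
  ∑ᶠ c : Coord p q, u c * contract (Gen.du c) σ T n u

/-- The pull-back by the flow `exp (ln s · v)` of the radial field, that is by `(n, u) ↦ (n, s u)`. -/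
def dilate {p q : ℕ} (s : ℝ) (σ : PreForm p q) : PreForm p q := fun T n u =>
  s ^ vdeg T * σ T n (s • u)

/-- `h_v σ = ∫_0^1 s⁻¹ exp (ln s · v)^* (v ⌟ σ) ds`. -/
def vertHomotopy {p q : ℕ} (σ : PreForm p q) : PreForm p q := fun T n u =>
  ∫ s in (0 : ℝ)..1, s⁻¹ * dilate s (radialContract σ) T n u

/-! The operators map forms to forms and are linear. -/

section degrees

variable {p q : ℕ}

theorem hdeg_insert_delta {i : Fin p} {T : Finset (Gen p q)} (h : Gen.delta i ∉ T) :
    hdeg (insert (Gen.delta i) T) = hdeg T + 1 := by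
  rw [hdeg, Finset.filter_insert, if_pos (by rfl), Finset.card_insert_of_notMem (by simp [h]), hdeg]

theorem vdeg_insert_delta {i : Fin p} {T : Finset (Gen p q)} :
    vdeg (insert (Gen.delta i) T) = vdeg T := by
  rw [vdeg, Finset.filter_insert, if_neg Bool.noConfusion, vdeg]

theorem hdeg_insert_du {c : Coord p q} {T : Finset (Gen p q)} :
    hdeg (insert (Gen.du c) T) = hdeg T := by
  rw [hdeg, Finset.filter_insert, if_neg Bool.noConfusion, hdeg]

theorem vdeg_insert_du {c : Coord p q} {T : Finset (Gen p q)} (h : Gen.du c ∉ T) :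
    vdeg (insert (Gen.du c) T) = vdeg T + 1 := by
  rw [vdeg, Finset.filter_insert, if_pos (by rfl), Finset.card_insert_of_notMem (by simp [h]), vdeg]

theorem hdeg_translate (K : Fin p → ℤ) (T : Finset (Gen p q)) :
    hdeg (T.image (Gen.translate K)) = hdeg T := by
  unfold hdeg
  rw [Finset.filter_image, Finset.card_image_of_injective _ (Gen.translate_strictMono K).injective]
  congr 1
  refine Finset.filter_congr fun g _ => ?_
  cases g <;> rfl

theorem vdeg_translate (K : Fin p → ℤ) (T : Finset (Gen p q)) :
    vdeg (T.image (Gen.translate K)) = vdeg T := by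
  unfold vdeg
  rw [Finset.filter_image, Finset.card_image_of_injective _ (Gen.translate_strictMono K).injective]
  congr 1
  refine Finset.filter_congr fun g _ => ?_
  cases g <;> rfl

theorem wedge_delta_mem {k l : ℕ} {σ : PreForm p q} (hσ : σ ∈ Forms p q k l) (i : Fin p) :
    wedge (Gen.delta i) σ ∈ Forms p q (k + 1) l := by
  obtain ⟨h1, B, hB⟩ := hσ
  refine ⟨fun T hT => ?_, B, fun T ⟨c, hc, hcT⟩ => ?_, fun T n => ?_⟩
  · by_cases hi : Gen.delta i ∈ T
    · have h0 : σ (T.erase (Gen.delta i)) ≠ 0 := fun h => hT (by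
        funext n u; simp [wedge, h])
      obtain ⟨ha, hb⟩ := h1 _ h0
      rw [← Finset.insert_erase hi, hdeg_insert_delta (Finset.notMem_erase _ _),
        vdeg_insert_delta, ha, hb]
      exact ⟨rfl, rfl⟩
    · exact absurd (by funext n u; simp [wedge, hi]) hT
  · have := hB.1 (T.erase (Gen.delta i)) ⟨c, hc, by simp [hcT]⟩
    funext n u; simp [wedge, this]
  · by_cases hi : Gen.delta i ∈ T
    · obtain ⟨g, hg, hg'⟩ := hB.2 (T.erase (Gen.delta i)) n
      exact ⟨fun v => sgn (Gen.delta i) T * g v, contDiff_const.mul hg,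
        fun u => by simp [wedge, hi, hg']⟩
    · convert SmoothIn.zero (B := B) using 1
      funext u; simp [wedge, hi]

theorem wedge_du_mem {k l : ℕ} {σ : PreForm p q} (hσ : σ ∈ Forms p q k l) (c : Coord p q) :
    wedge (Gen.du c) σ ∈ Forms p q k (l + 1) := by
  classical
  obtain ⟨h1, B, hB⟩ := hσ
  refine ⟨fun T hT => ?_, insert c B, fun T ⟨d, hd, hdT⟩ => ?_, fun T n => ?_⟩
  · by_cases hi : Gen.du c ∈ T
    · have h0 : σ (T.erase (Gen.du c)) ≠ 0 := fun h => hT (by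
        funext n u; simp [wedge, h])
      obtain ⟨ha, hb⟩ := h1 _ h0
      rw [← Finset.insert_erase hi, vdeg_insert_du (Finset.notMem_erase _ _),
        hdeg_insert_du, ha, hb]
      exact ⟨rfl, rfl⟩
    · exact absurd (by funext n u; simp [wedge, hi]) hT
  · have hne : d ≠ c ∧ d ∉ B := by simpa using hd
    have := hB.1 (T.erase (Gen.du c)) ⟨d, hne.2, by simp [hdT, hne.1]⟩
    funext n u; simp [wedge, this]
  · refine SmoothIn.mono (Finset.subset_insert c B) ?_
    by_cases hi : Gen.du c ∈ T
    · obtain ⟨g, hg, hg'⟩ := hB.2 (T.erase (Gen.du c)) n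
      exact ⟨fun v => sgn (Gen.du c) T * g v, contDiff_const.mul hg,
        fun u => by simp [wedge, hi, hg']⟩
    · convert SmoothIn.zero (B := B) using 1
      funext u; simp [wedge, hi]

theorem contract_du_mem {k l : ℕ} {σ : PreForm p q} (hσ : σ ∈ Forms p q k (l + 1))
    (c : Coord p q) : contract (Gen.du c) σ ∈ Forms p q k l := by
  obtain ⟨h1, B, hB⟩ := hσ
  refine ⟨fun T hT => ?_, B, fun T ⟨d, hd, hdT⟩ => ?_, fun T n => ?_⟩
  · by_cases hi : Gen.du c ∈ T
    · exact absurd (by funext n u; simp [contract, hi]) hT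
    · have h0 : σ (insert (Gen.du c) T) ≠ 0 := fun h => hT (by
        funext n u; simp [contract, h])
      have := h1 _ h0
      rw [hdeg_insert_du, vdeg_insert_du hi] at this
      exact ⟨this.1, by omega⟩
  · have := hB.1 (insert (Gen.du c) T) ⟨d, hd, by simp [hdT]⟩
    funext n u; simp [contract, this]
  · by_cases hi : Gen.du c ∈ T
    · convert SmoothIn.zero (B := B) using 1
      funext u; simp [contract, hi]
    · obtain ⟨g, hg, hg'⟩ := hB.2 (insert (Gen.du c) T) n
      exact ⟨fun v => sgn (Gen.du c) T * g v, contDiff_const.mul hg,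
        fun u => by simp [contract, hi, hg']⟩

theorem contract_eq_zero {B : Finset (Coord p q)} {σ : PreForm p q} (hσ : IsLocal B σ)
    {c : Coord p q} (hc : c ∉ B) : contract (Gen.du c) σ = 0 := by
  funext T n u
  have := hσ.1 (insert (Gen.du c) T) ⟨c, hc, by simp⟩
  simp [contract, this]

theorem shift_mem {k l : ℕ} {σ : PreForm p q} (hσ : σ ∈ Forms p q k l) (K : Fin p → ℤ) :
    shift K σ ∈ Forms p q k l := by
  classical
  obtain ⟨h1, B, hB⟩ := hσ
  refine ⟨fun T hT => ?_, B.image fun c => (c.1, c.2 + K), fun T ⟨d, hd, hdT⟩ => ?_,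
    fun T n => ?_⟩
  · have h0 : σ (T.image (Gen.translate (-K))) ≠ 0 := fun h => hT (by
      funext n u; simp [shift, h])
    have := h1 _ h0
    rwa [hdeg_translate, vdeg_translate] at this
  · have := hB.1 (T.image (Gen.translate (-K))) ⟨(d.1, d.2 + -K), fun h => hd ?_, ?_⟩
    · funext n u; simp [shift, this]
    · exact Finset.mem_image.2 ⟨_, h, by simp⟩
    · exact Finset.mem_image.2 ⟨_, hdT, rfl⟩
  · obtain ⟨g, hg, hg'⟩ := hB.2 (T.image (Gen.translate (-K))) (n + K)
    refine ⟨fun v => g fun b => v ⟨(b.1.1, b.1.2 + K), Finset.mem_image_of_mem _ b.2⟩,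
      hg.comp (contDiff_pi.2 fun b => contDiff_apply ℝ ℝ _), fun u => ?_⟩
    simp [shift, hg']

theorem IsLocal.hasDerivAt {B : Finset (Coord p q)} {σ : PreForm p q} (hσ : IsLocal B σ)
    (c : Coord p q) (T : Finset (Gen p q)) (n : Fin p → ℤ) (u : Prol p q) :
    HasDerivAt (fun t => σ T n (Function.update u c t)) (pd c σ T n u) (u c) := by
  obtain ⟨g, hg, hg'⟩ := hσ.2 T n
  refine DifferentiableAt.hasDerivAt ?_
  have h : (fun t => σ T n (Function.update u c t)) =
      g ∘ fun t => fun b : B => Function.update u c t b := funext fun t => hg' _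
  rw [h]
  refine ((hg.differentiable (by simp)).comp ?_) _
  refine differentiable_pi.2 fun b => ?_
  by_cases hb : (b : Coord p q) = c
  · simp [hb, Function.update_self, differentiable_fun_id]
  · simp [hb, Function.update_of_ne]

theorem pd_eq_zero {B : Finset (Coord p q)} {σ : PreForm p q} (hσ : IsLocal B σ)
    {c : Coord p q} (hc : c ∉ B) : pd c σ = 0 := by
  funext T n u
  obtain ⟨g, hg, hg'⟩ := hσ.2 T n
  have : (fun t => σ T n (Function.update u c t)) = fun _ => σ T n u := by
    funext t
    rw [hg', hg']
    congr 1
    funext b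
    exact Function.update_of_ne (by rintro rfl; exact hc b.2) _ _
  simp [pd, this]

theorem pd_mem {k l : ℕ} {σ : PreForm p q} (hσ : σ ∈ Forms p q k l) (c : Coord p q) :
    pd c σ ∈ Forms p q k l := by
  classical
  obtain ⟨h1, B, hB⟩ := hσ
  refine ⟨fun T hT => h1 T fun h => hT ?_, B, fun T h => ?_, fun T n => ?_⟩
  · funext n u; simp [pd, h]
  · funext n u; simp [pd, hB.1 T h]
  · by_cases hc : c ∈ B
    · obtain ⟨g, hg, hg'⟩ := hB.2 T n
      refine ⟨fun v => fderiv ℝ g v (Pi.single ⟨c, hc⟩ 1),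
        (hg.fderiv_right (m := ∞) (by simp)).clm_apply contDiff_const, fun u => ?_⟩
      have h : (fun t => σ T n (Function.update u c t)) =
          g ∘ Function.update (fun b : B => u b) ⟨c, hc⟩ := by
        funext t
        rw [hg']
        simp only [Function.comp]
        congr 1
        funext b
        by_cases hb : b = ⟨c, hc⟩
        · subst hb; simp
        · rw [Function.update_of_ne hb, Function.update_of_ne fun h => hb (Subtype.ext h)]
      have hd := hasDerivAt_update (𝕜 := ℝ) (fun b : B => u b) ⟨c, hc⟩ (u c)
      have hf : HasFDerivAt g (fderiv ℝ g (fun b : B => u b))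
          (Function.update (fun b : B => u b) ⟨c, hc⟩ (u c)) := by
        have e : Function.update (fun b : B => u b) ⟨c, hc⟩ (u c) = fun b : B => u b :=
          Function.update_eq_self (⟨c, hc⟩ : B) (fun b : B => u b)
        rw [e]
        exact (hg.differentiable (by simp) _).hasFDerivAt
      have := (hf.comp_hasDerivAt (u c) hd).deriv
      simpa [pd, h] using this
    · rw [pd_eq_zero hB hc]
      exact SmoothIn.zero

theorem wedge_zero (g : Gen p q) : wedge g (0 : PreForm p q) = 0 := by
  funext T n u; simp [wedge]

theorem shift_zero (K : Fin p → ℤ) : shift K (0 : PreForm p q) = 0 := rfl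

theorem extDiff_mem {k l : ℕ} {σ : PreForm p q} (hσ : σ ∈ Forms p q k l) :
    extDiff σ ∈ Forms p q (k + 1) l :=
  Submodule.sum_mem _ fun i _ => wedge_delta_mem (Submodule.sub_mem _ (shift_mem hσ _) hσ) i

theorem vertDeriv_eq_sum {B : Finset (Coord p q)} {σ : PreForm p q} (hσ : IsLocal B σ) :
    vertDeriv σ = ∑ c ∈ B, wedge (Gen.du c) (pd c σ) := by
  funext T n u
  rw [vertDeriv, finsum_eq_sum_of_support_subset (s := B)]
  · simp [Finset.sum_apply]
  · intro c hc
    by_contra h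
    exact hc (by simp [pd_eq_zero hσ h, wedge_zero])

theorem vertDeriv_mem {k l : ℕ} {σ : PreForm p q} (hσ : σ ∈ Forms p q k l) :
    vertDeriv σ ∈ Forms p q k (l + 1) := by
  obtain ⟨B, hB⟩ := hσ.2
  rw [vertDeriv_eq_sum hB]
  exact Submodule.sum_mem _ fun c _ => wedge_du_mem (pd_mem hσ c) c

theorem interiorEuler_eq_sum {B : Finset (Coord p q)} {σ : PreForm p q} (hσ : IsLocal B σ)
    (l : ℕ) : interiorEuler l σ = (1 / (l : ℝ)) • ∑ c ∈ B,
      wedge (Gen.du (c.1, 0)) (shift (-c.2) (contract (Gen.du c) σ)) := by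
  funext T n u
  rw [interiorEuler, finsum_eq_sum_of_support_subset (s := B)]
  · simp [Finset.sum_apply]
  · intro c hc
    by_contra h
    exact hc (by simp [contract_eq_zero hσ h, wedge_zero, shift_zero])

theorem interiorEuler_mem {k l : ℕ} {σ : PreForm p q} (hσ : σ ∈ Forms p q k l) :
    interiorEuler l σ ∈ Forms p q k l := by
  obtain ⟨B, hB⟩ := hσ.2
  rw [interiorEuler_eq_sum hB]
  cases l with
  | zero => simp
  | succ l =>
    exact Submodule.smul_mem _ _ <| Submodule.sum_mem _ fun c _ =>
      wedge_du_mem (shift_mem (contract_du_mem hσ c) _) _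

theorem radialContract_eq_sum {B : Finset (Coord p q)} {σ : PreForm p q} (hσ : IsLocal B σ)
    (T : Finset (Gen p q)) (n : Fin p → ℤ) (u : Prol p q) :
    radialContract σ T n u = ∑ c ∈ B, u c * contract (Gen.du c) σ T n u := by
  rw [radialContract, finsum_eq_sum_of_support_subset (s := B)]
  intro c hc
  by_contra h
  exact hc (by simp [contract_eq_zero hσ h])

theorem hasFDerivAt_param {V W : Type} [NormedAddCommGroup V] [NormedSpace ℝ V]
    [FiniteDimensional ℝ V] [NormedAddCommGroup W] [NormedSpace ℝ W] [CompleteSpace W]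
    {f : ℝ → V → W} (hf : ContDiff ℝ ∞ (fun x : ℝ × V => f x.1 x.2)) (v : V) :
    HasFDerivAt (fun v => ∫ s in (0 : ℝ)..1, f s v)
      (∫ s in (0 : ℝ)..1, fderiv ℝ (f s) v) v := by
  have hd : Continuous (fun x : ℝ × V => fderiv ℝ (f x.1) x.2) :=
    ContDiff.continuous (𝕜 := ℝ) (n := ∞) <|
      ContDiff.fderiv (f := fun (x : ℝ × V) (w : V) => f x.1 w) (g := fun x : ℝ × V => x.2)
        (m := ∞) (n := ∞)
        (hf.comp ((contDiff_fst.comp contDiff_fst).prodMk contDiff_snd)) contDiff_snd (by simp)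
  have hfs : ∀ w, Continuous fun s => f s w := fun w =>
    hf.continuous.comp (Continuous.prodMk continuous_id continuous_const)
  obtain ⟨C, hC⟩ := ((isCompact_Icc (a := (0 : ℝ)) (b := 1)).prod
    (isCompact_closedBall v 1)).exists_bound_of_continuousOn hd.continuousOn
  refine intervalIntegral.hasFDerivAt_integral_of_dominated_of_fderiv_le
    (bound := fun _ => C) (F := fun v s => f s v) (F' := fun v s => fderiv ℝ (f s) v)
    (Metric.closedBall_mem_nhds v one_pos)
    (Filter.Eventually.of_forall fun w => (hfs w).aestronglyMeasurable)
    ((hfs v).intervalIntegrable _ _)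
    (hd.comp (Continuous.prodMk continuous_id continuous_const)).aestronglyMeasurable
    (Filter.Eventually.of_forall fun s hs w hw => hC (s, w) ⟨?_, hw⟩)
    intervalIntegrable_const (Filter.Eventually.of_forall fun s hs w hw => ?_)
  · rw [Set.uIoc_of_le zero_le_one] at hs; exact ⟨hs.1.le, hs.2⟩
  · have : ContDiff ℝ ∞ (f s) := hf.comp (contDiff_const.prodMk contDiff_id)
    exact (this.differentiable (by simp) w).hasFDerivAt

theorem contDiff_param {V : Type} [NormedAddCommGroup V] [NormedSpace ℝ V]
    [FiniteDimensional ℝ V] (m : ℕ) :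
    ∀ {W : Type} [NormedAddCommGroup W] [NormedSpace ℝ W] [CompleteSpace W] {f : ℝ → V → W},
      ContDiff ℝ ∞ (fun x : ℝ × V => f x.1 x.2) →
      ContDiff ℝ m (fun v => ∫ s in (0 : ℝ)..1, f s v) := by
  induction m with
  | zero =>
    intro W _ _ _ f hf
    exact contDiff_zero.2 
      (continuous_iff_continuousAt.2 fun v => (hasFDerivAt_param hf v).continuousAt)
  | succ m ih =>
    intro W _ _ _ f hf
    push_cast
    refine contDiff_succ_iff_fderiv.2 ⟨fun v => (hasFDerivAt_param hf v).differentiableAt,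
      by simp, ?_⟩
    have h : fderiv ℝ (fun v => ∫ s in (0 : ℝ)..1, f s v) =
        fun v => ∫ s in (0 : ℝ)..1, fderiv ℝ (f s) v :=
      funext fun v => (hasFDerivAt_param hf v).fderiv
    rw [h]
    exact ih (f := fun s v => fderiv ℝ (f s) v) <|
      ContDiff.fderiv (f := fun (x : ℝ × V) (w : V) => f x.1 w) (g := fun x : ℝ × V => x.2)
        (m := ∞) (n := ∞)
        (hf.comp ((contDiff_fst.comp contDiff_fst).prodMk contDiff_snd)) contDiff_snd (by simp)

theorem vertHomotopy_eq {k l : ℕ} {σ : PreForm p q} (hσ : σ ∈ Forms p q k (l + 1))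
    {B : Finset (Coord p q)} (hB : IsLocal B σ) (T : Finset (Gen p q)) (n : Fin p → ℤ)
    (u : Prol p q) : vertHomotopy σ T n u =
      ∫ s in (0 : ℝ)..1, s ^ l * ∑ c ∈ B, u c * contract (Gen.du c) σ T n (s • u) := by
  refine intervalIntegral.integral_congr_ae (Filter.Eventually.of_forall fun s hs => ?_)
  rw [Set.uIoc_of_le zero_le_one] at hs
  have hs0 : s ≠ 0 := hs.1.ne'
  rw [dilate, radialContract_eq_sum hB]
  by_cases hT : vdeg T = l
  · simp only [hT, Pi.smul_apply, smul_eq_mul, mul_assoc, ← Finset.mul_sum]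
    field_simp
  · have h0 : ∀ c, contract (Gen.du c) σ T = 0 := fun c => by
      by_contra h
      exact hT ((contract_du_mem hσ c).1 T h).2
    simp [h0]

theorem vertHomotopy_mem {k l : ℕ} {σ : PreForm p q} (hσ : σ ∈ Forms p q k (l + 1)) :
    vertHomotopy σ ∈ Forms p q k l := by
  obtain ⟨h1, B, hB⟩ := id hσ
  refine ⟨fun T hT => ?_, B, fun T ⟨d, hd, hdT⟩ => ?_, fun T n => ?_⟩
  · by_contra h
    have h0 : ∀ c, contract (Gen.du c) σ T = 0 := fun c => by
      by_contra h'
      exact h ((contract_du_mem hσ c).1 T h')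
    exact hT (by funext n u; simp [vertHomotopy_eq hσ hB, h0])
  · have h0 : ∀ c, contract (Gen.du c) σ T = 0 := fun c => by
      have := hB.1 (insert (Gen.du c) T) ⟨d, hd, by simp [hdT]⟩
      funext n u
      simp [contract, this]
    funext n u; simp [vertHomotopy_eq hσ hB, h0]
  · have h0 : ∀ c, ∃ g : (B → ℝ) → ℝ, ContDiff ℝ ∞ g ∧
        ∀ u, contract (Gen.du c) σ T n u = g (fun b => u b) := fun c => by
      by_cases hi : Gen.du c ∈ T
      · exact ⟨fun _ => 0, contDiff_const, fun u => by simp [contract, hi]⟩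
      · obtain ⟨g, hg, hg'⟩ := hB.2 (insert (Gen.du c) T) n
        exact ⟨fun v => sgn (Gen.du c) T * g v, contDiff_const.mul hg,
          fun u => by simp [contract, hi, hg']⟩
    choose g hg hg' using h0
    refine ⟨fun v => ∫ s in (0 : ℝ)..1, s ^ l * ∑ c : B, v c * g c (s • v),
      contDiff_infty.2 fun m => contDiff_param m ?_, fun u => ?_⟩
    · refine (contDiff_fst.pow l).mul (ContDiff.sum fun c _ => ?_)
      exact ((contDiff_apply ℝ ℝ c).comp contDiff_snd).mul
        ((hg c).comp (contDiff_fst.smul contDiff_snd))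
    · rw [vertHomotopy_eq hσ hB]
      refine intervalIntegral.integral_congr fun s _ => ?_
      simp only [hg']
      rw [← Finset.sum_coe_sort B]
      rfl

theorem wedge_add (g : Gen p q) (σ τ : PreForm p q) :
    wedge g (σ + τ) = wedge g σ + wedge g τ := by
  funext T n u
  by_cases h : g ∈ T <;> simp [wedge, h, mul_add]

theorem wedge_smul (g : Gen p q) (a : ℝ) (σ : PreForm p q) :
    wedge g (a • σ) = a • wedge g σ := by
  funext T n u
  by_cases h : g ∈ T <;> simp [wedge, h, mul_left_comm]

theorem contract_add (g : Gen p q) (σ τ : PreForm p q) :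
    contract g (σ + τ) = contract g σ + contract g τ := by
  funext T n u
  by_cases h : g ∈ T <;> simp [contract, h, mul_add]

theorem contract_smul (g : Gen p q) (a : ℝ) (σ : PreForm p q) :
    contract g (a • σ) = a • contract g σ := by
  funext T n u
  by_cases h : g ∈ T <;> simp [contract, h, mul_left_comm]

theorem shift_add (K : Fin p → ℤ) (σ τ : PreForm p q) :
    shift K (σ + τ) = shift K σ + shift K τ := rfl

theorem shift_smul (K : Fin p → ℤ) (a : ℝ) (σ : PreForm p q) :
    shift K (a • σ) = a • shift K σ := rfl

theorem exists_isLocal_pair {k l : ℕ} (σ τ : Forms p q k l) :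
    ∃ B, IsLocal B (σ : PreForm p q) ∧ IsLocal B (τ : PreForm p q) := by
  classical
  obtain ⟨B, hB⟩ := σ.2.2
  obtain ⟨C, hC⟩ := τ.2.2
  exact ⟨B ∪ C, hB.mono Finset.subset_union_left, hC.mono Finset.subset_union_right⟩

theorem IsLocal.add {B : Finset (Coord p q)} {σ τ : PreForm p q} (hσ : IsLocal B σ)
    (hτ : IsLocal B τ) : IsLocal B (σ + τ) := by
  refine ⟨fun T h => by simp [hσ.1 T h, hτ.1 T h], fun T n => ?_⟩
  obtain ⟨f, hf, hf'⟩ := hσ.2 T n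
  obtain ⟨g, hg, hg'⟩ := hτ.2 T n
  exact ⟨fun v => f v + g v, hf.add hg, fun u => by simp [hf', hg']⟩

theorem IsLocal.smul {B : Finset (Coord p q)} {σ : PreForm p q} (hσ : IsLocal B σ) (a : ℝ) :
    IsLocal B (a • σ) := by
  refine ⟨fun T h => by simp [hσ.1 T h], fun T n => ?_⟩
  obtain ⟨f, hf, hf'⟩ := hσ.2 T n
  exact ⟨fun v => a * f v, contDiff_const.mul hf, fun u => by simp [hf']⟩

theorem IsLocal.continuous_contract {B : Finset (Coord p q)} {σ : PreForm p q} (hσ : IsLocal B σ)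
    (c : Coord p q) (T : Finset (Gen p q)) (n : Fin p → ℤ) (u : Prol p q) :
    Continuous fun s : ℝ => contract (Gen.du c) σ T n (s • u) := by
  by_cases hi : Gen.du c ∈ T
  · simp only [contract, hi, if_true]
    exact continuous_const
  · obtain ⟨g, hg, hg'⟩ := hσ.2 (insert (Gen.du c) T) n
    simp only [contract, hi, if_false, hg']
    refine continuous_const.mul (hg.continuous.comp (continuous_pi fun b => ?_))
    exact continuous_id.mul continuous_const

end degrees

/-- `d_h^Δ : Ω^{k,l} → Ω^{k+1,l}`. -/
def dH (p q k l : ℕ) : Forms p q k l →ₗ[ℝ] Forms p q (k + 1) l where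
  toFun σ := ⟨extDiff σ, extDiff_mem σ.2⟩
  map_add' σ τ := Subtype.ext <| by
    simp only [extDiff, diff, Submodule.coe_add, shift_add, ← Finset.sum_add_distrib, ← wedge_add]
    refine Finset.sum_congr rfl fun i _ => ?_
    congr 1
    abel
  map_smul' a σ := Subtype.ext <| by
    simp only [extDiff, diff, Submodule.coe_smul, shift_smul, ← smul_sub, wedge_smul,
      ← Finset.smul_sum, RingHom.id_apply]

/-- `d_v : Ω^{k,l} → Ω^{k,l+1}`. -/
def dV (p q k l : ℕ) : Forms p q k l →ₗ[ℝ] Forms p q k (l + 1) where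
  toFun σ := ⟨vertDeriv σ, vertDeriv_mem σ.2⟩
  map_add' σ τ := Subtype.ext <| by
    obtain ⟨B, hσ, hτ⟩ := exists_isLocal_pair σ τ
    simp only [Submodule.coe_add, vertDeriv_eq_sum hσ, vertDeriv_eq_sum hτ,
      vertDeriv_eq_sum (hσ.add hτ), ← Finset.sum_add_distrib, ← wedge_add]
    refine Finset.sum_congr rfl fun c _ => ?_
    congr 1
    funext T n u
    exact ((hσ.hasDerivAt c T n u).add (hτ.hasDerivAt c T n u)).deriv
  map_smul' a σ := Subtype.ext <| by
    obtain ⟨B, hσ⟩ := σ.2.2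
    simp only [Submodule.coe_smul, vertDeriv_eq_sum hσ, vertDeriv_eq_sum (hσ.smul a),
      Finset.smul_sum, ← wedge_smul, RingHom.id_apply]
    refine Finset.sum_congr rfl fun c _ => ?_
    congr 1
    funext T n u
    exact ((hσ.hasDerivAt c T n u).const_mul a).deriv

/-- The difference interior Euler operator `I^Δ : Ω^{p,l} → Ω^{p,l}`, for `l ≥ 1`. -/
def euler (p q l : ℕ) : Forms p q p l →ₗ[ℝ] Forms p q p l where
  toFun σ := ⟨interiorEuler l σ, interiorEuler_mem σ.2⟩
  map_add' σ τ := Subtype.ext <| by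
    obtain ⟨B, hσ, hτ⟩ := exists_isLocal_pair σ τ
    simp only [Submodule.coe_add, interiorEuler_eq_sum hσ, interiorEuler_eq_sum hτ,
      interiorEuler_eq_sum (hσ.add hτ), ← smul_add, ← Finset.sum_add_distrib, contract_add,
      shift_add, wedge_add]
  map_smul' a σ := Subtype.ext <| by
    obtain ⟨B, hσ⟩ := σ.2.2
    simp only [Submodule.coe_smul, interiorEuler_eq_sum hσ, interiorEuler_eq_sum (hσ.smul a),
      contract_smul, shift_smul, wedge_smul, ← Finset.smul_sum, RingHom.id_apply,
      smul_comm a]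

/-- The vertical homotopy operator `h_v : Ω^{k,l+1} → Ω^{k,l}`. -/
def hV (p q k l : ℕ) : Forms p q k (l + 1) →ₗ[ℝ] Forms p q k l where
  toFun σ := ⟨vertHomotopy σ, vertHomotopy_mem σ.2⟩
  map_add' σ τ := Subtype.ext <| by
    obtain ⟨B, hσ, hτ⟩ := exists_isLocal_pair σ τ
    funext T n u
    have hi : ∀ {ρ : PreForm p q}, IsLocal B ρ → IntervalIntegrable
        (fun s : ℝ => s ^ l * ∑ c ∈ B, u c * contract (Gen.du c) ρ T n (s • u))
        MeasureTheory.volume 0 1 := fun hρ =>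
      ((continuous_id.pow l).mul (continuous_finsetSum _ fun c _ =>
        continuous_const.mul (hρ.continuous_contract c T n u))).intervalIntegrable _ _
    simp only [Pi.add_apply, Submodule.coe_add, vertHomotopy_eq σ.2 hσ, vertHomotopy_eq τ.2 hτ]
    rw [vertHomotopy_eq (add_mem σ.2 τ.2) (hσ.add hτ), ← intervalIntegral.integral_add (hi hσ) (hi hτ)]
    refine intervalIntegral.integral_congr fun s _ => ?_
    simp only [contract_add, Pi.add_apply, mul_add, Finset.sum_add_distrib]
  map_smul' a σ := Subtype.ext <| by
    obtain ⟨B, hσ⟩ := σ.2.2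
    funext T n u
    simp only [Submodule.coe_smul, Pi.smul_apply, smul_eq_mul, RingHom.id_apply,
      vertHomotopy_eq σ.2 hσ]
    rw [vertHomotopy_eq (Submodule.smul_mem _ a σ.2) (hσ.smul a), ← intervalIntegral.integral_const_mul]
    refine intervalIntegral.integral_congr fun s _ => ?_
    simp only [contract_smul, Pi.smul_apply, smul_eq_mul, Finset.mul_sum]
    refine Finset.sum_congr rfl fun c _ => ?_
    ring

/-- `F^l = I^Δ(Ω^{p,l})`, for `l ≥ 1`. -/
def F (p q l : ℕ) : Submodule ℝ (Forms p q p l) := LinearMap.range (euler p q l)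

/-- The inclusion `ℝ → Ω^{0,0}` of the constants. -/
def const (p q : ℕ) : ℝ →ₗ[ℝ] Forms p q 0 0 where
  toFun a := ⟨fun T _ _ => if T = ∅ then a else 0, fun T hT => by
      by_cases h : T = ∅
      · subst h; exact ⟨rfl, rfl⟩
      · exact absurd (by funext n u; simp [h]) hT, ∅, fun T ⟨c, _, hc⟩ => by
      have h : T ≠ ∅ := fun h => by simp [h] at hc
      funext n u; simp [h], fun T n => ⟨fun _ => if T = ∅ then a else 0, contDiff_const,
        fun _ => rfl⟩⟩
  map_add' a b := Subtype.ext <| by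
    funext T n u
    by_cases h : T = ∅ <;> simp [h]
  map_smul' a b := Subtype.ext <| by
    funext T n u
    by_cases h : T = ∅ <;> simp [h]

/-- The difference Euler–Lagrange operator `E^Δ = I^Δ d_v : Ω^{p,0} → F^1`. -/
def eulerLagrange (p q : ℕ) : Forms p q p 0 →ₗ[ℝ] F p q 1 :=
  (euler p q 1).rangeRestrict ∘ₗ dV p q p 0

/-- `δ_v^Δ = I^Δ d_v : F^l → F^{l+1}`, for `l ≥ 1`. -/
def deltaV (p q l : ℕ) : F p q l →ₗ[ℝ] F p q (l + 1) :=
  (euler p q (l + 1)).rangeRestrict ∘ₗ dV p q p l ∘ₗ (F p q l).subtype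

/-- `H^{l+1} = I^Δ ∘ h_v : F^{l+1} → F^l`, for `l ≥ 1`. -/
def homotopyF (p q l : ℕ) : F p q (l + 1) →ₗ[ℝ] F p q l :=
  (euler p q l).rangeRestrict ∘ₗ hV p q p l ∘ₗ (F p q (l + 1)).subtype

end DVB

end

/-! Two Cartan formulas carry the proof. Write ι_i for contraction with the dual of Δ^i.
Horizontally, d_h ι_i + ι_i d_h = S_i - id (`extDiff_contract`), so shifts act trivially on
d_h-cohomology. In horizontal degree p every form is closed, so each du_c ∧ ι_c σ can be moved to
the label J = 0 modulo exact forms; since these terms add up to l σ, σ - I^Δ σ is d_h-exact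
(`sub_interiorEuler_exact`). Conversely I^Δ is invariant under shifts and hence kills d_h-exact
forms (`euler_dH`). So for l ≥ 1, I^Δ is a projector with kernel im d_h, and F^l is a copy of
Ω^{p,l} / d_h Ω^{p-1,l}.

Vertically, d_v h_v + h_v d_v = id for l ≥ 1 (`vert_homotopy_formula`). Both operators anticommute
with d_h, so they descend to the quotients F^l; this gives the two homotopy identities and exactness
along F^1 → F^2 → ⋯. For l = 0 one has h_v d_v σ = σ - σ(n,0). If E^Δ(L) = 0, then d_v L = d_h τ,
and h_v gives L - L(n,0) = -d_h h_v τ; the term L(n,0) is exact on the lattice.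

For the horizontal complex, split σ = σ(n,0) + rest and insert an antidifference h in direction i
into Cartan's formula (`extDiff_contract_add`). On the part independent of u, summation along the
lattice is a right inverse of S_i - id, and Δ^i can be removed from all monomials modulo exact
forms; once this is done for every i, nothing of positive degree is left. The rest lives in a finite
window of labels and vanishes at u = 0; there a truncated sum of shifts is a left inverse of S_i -
id, and Δ^i can be forced into every monomial. A form containing every Δ^i has degree p, so below
degree p nothing is left. -/

noncomputable section

namespace DVB

/-! ### Exterior algebra on the generators, shifts and partial derivatives -/

section operators

variable {p q : ℕ}

theorem sgn_mul_self (g : Gen p q) (T : Finset (Gen p q)) : sgn g T * sgn g T = 1 := by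
  rw [sgn, ← mul_pow]; simp

theorem sgn_erase_of_not_lt {g h : Gen p q} (hg : ¬ h < g) (T : Finset (Gen p q)) :
    sgn g (T.erase h) = sgn g T := by
  unfold sgn
  congr 2
  ext x
  simp only [Finset.mem_filter, Finset.mem_erase]
  exact ⟨fun hx => ⟨hx.1.2, hx.2⟩, fun hx => ⟨⟨fun e => hg (e ▸ hx.2), hx.1⟩, hx.2⟩⟩

theorem sgn_erase_of_lt {g h : Gen p q} (hg : h < g) {T : Finset (Gen p q)} (hT : h ∈ T) :
    sgn g (T.erase h) = - sgn g T := by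
  unfold sgn
  have : T.filter (· < g) = insert h ((T.erase h).filter (· < g)) := by
    ext x
    simp only [Finset.mem_filter, Finset.mem_erase, Finset.mem_insert]
    by_cases hx : x = h
    · subst hx; simp [hT, hg]
    · simp [hx]
  rw [this, Finset.card_insert_of_notMem (by simp), pow_succ]
  ring

theorem sgn_insert_of_not_lt {g h : Gen p q} (hg : ¬ h < g) (T : Finset (Gen p q)) :
    sgn g (insert h T) = sgn g T := by
  by_cases hT : h ∈ T
  · rw [Finset.insert_eq_of_mem hT]
  · rw [← sgn_erase_of_not_lt hg (insert h T), Finset.erase_insert hT]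

theorem sgn_insert_of_lt {g h : Gen p q} (hg : h < g) {T : Finset (Gen p q)} (hT : h ∉ T) :
    sgn g (insert h T) = - sgn g T := by
  have := sgn_erase_of_lt hg (Finset.mem_insert_self h T)
  rw [Finset.erase_insert hT] at this
  rw [this, neg_neg]

/-- The exterior product with a generator, as a linear map. -/
def wedgeL (g : Gen p q) : PreForm p q →ₗ[ℝ] PreForm p q where
  toFun := wedge g
  map_add' := wedge_add g
  map_smul' := wedge_smul g

@[simp] theorem wedgeL_apply (g : Gen p q) (σ : PreForm p q) : wedgeL g σ = wedge g σ := rfl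

/-- The interior product with the dual of a generator, as a linear map. -/
def contractL (g : Gen p q) : PreForm p q →ₗ[ℝ] PreForm p q where
  toFun := contract g
  map_add' := contract_add g
  map_smul' := contract_smul g

@[simp] theorem contractL_apply (g : Gen p q) (σ : PreForm p q) : contractL g σ = contract g σ := rfl

/-- The shift as a linear map. -/
def shiftL (K : Fin p → ℤ) : PreForm p q →ₗ[ℝ] PreForm p q where
  toFun := shift K
  map_add' := shift_add K
  map_smul' := shift_smul K

@[simp] theorem shiftL_apply (K : Fin p → ℤ) (σ : PreForm p q) : shiftL K σ = shift K σ := rfl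

theorem wedge_sub (g : Gen p q) (σ τ : PreForm p q) :
    wedge g (σ - τ) = wedge g σ - wedge g τ := map_sub (wedgeL g) σ τ

theorem wedge_sum {ι : Type*} (g : Gen p q) (s : Finset ι) (σ : ι → PreForm p q) :
    wedge g (∑ i ∈ s, σ i) = ∑ i ∈ s, wedge g (σ i) := map_sum (wedgeL g) σ s

theorem contract_zero (g : Gen p q) : contract g (0 : PreForm p q) = 0 :=
  map_zero (contractL g)

theorem contract_sub (g : Gen p q) (σ τ : PreForm p q) :
    contract g (σ - τ) = contract g σ - contract g τ := map_sub (contractL g) σ τ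

theorem contract_sum {ι : Type*} (g : Gen p q) (s : Finset ι) (σ : ι → PreForm p q) :
    contract g (∑ i ∈ s, σ i) = ∑ i ∈ s, contract g (σ i) := map_sum (contractL g) σ s

theorem shift_sub (K : Fin p → ℤ) (σ τ : PreForm p q) :
    shift K (σ - τ) = shift K σ - shift K τ := rfl

theorem shift_sum {ι : Type*} (K : Fin p → ℤ) (s : Finset ι) (σ : ι → PreForm p q) :
    shift K (∑ i ∈ s, σ i) = ∑ i ∈ s, shift K (σ i) := map_sum (shiftL K) σ s

theorem wedge_self (g : Gen p q) (σ : PreForm p q) : wedge g (wedge g σ) = 0 := by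
  funext T n u
  simp [wedge]

theorem contract_self (g : Gen p q) (σ : PreForm p q) : contract g (contract g σ) = 0 := by
  funext T n u
  simp [contract]

/-- For g < h, removing g lowers by one the number of factors preceding h, while removing h does not
affect g. This is the only source of the minus sign. -/
theorem wedge_anticomm (g h : Gen p q) (σ : PreForm p q) :
    wedge g (wedge h σ) = - wedge h (wedge g σ) := by
  wlog hlt : g < h generalizing g h
  · rcases (not_lt.1 hlt).eq_or_lt with rfl | hlt
    · simp [wedge_self]
    · rw [this h g hlt, neg_neg]
  funext T n u
  have hne := hlt.ne
  simp only [wedge, Pi.neg_apply, Finset.mem_erase]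
  by_cases hg : g ∈ T <;> by_cases hh : h ∈ T <;> simp [hg, hh, hne, hne.symm]
  rw [sgn_erase_of_lt hlt hg, sgn_erase_of_not_lt hlt.not_gt, Finset.erase_right_comm]
  ring

theorem contract_anticomm (g h : Gen p q) (σ : PreForm p q) :
    contract g (contract h σ) = - contract h (contract g σ) := by
  wlog hlt : g < h generalizing g h
  · rcases (not_lt.1 hlt).eq_or_lt with rfl | hlt
    · simp [contract_self]
    · rw [this h g hlt, neg_neg]
  funext T n u
  have hne := hlt.ne
  simp only [contract, Pi.neg_apply, Finset.mem_insert]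
  by_cases hg : g ∈ T <;> by_cases hh : h ∈ T <;> simp [hg, hh, hne, hne.symm]
  rw [sgn_insert_of_lt hlt hg, sgn_insert_of_not_lt hlt.not_gt, Finset.insert_comm]
  ring

theorem contract_wedge_self (g : Gen p q) (σ : PreForm p q) :
    contract g (wedge g σ) + wedge g (contract g σ) = σ := by
  funext T n u
  simp only [contract, wedge, Pi.add_apply]
  by_cases hg : g ∈ T
  · simp [hg, sgn_erase_of_not_lt, ← mul_assoc, sgn_mul_self]
  · simp [hg, sgn_insert_of_not_lt, ← mul_assoc, sgn_mul_self]

theorem contract_wedge_of_ne {g h : Gen p q} (hne : g ≠ h) (σ : PreForm p q) :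
    contract g (wedge h σ) = - wedge h (contract g σ) := by
  funext T n u
  simp only [contract, wedge, Pi.neg_apply, Finset.mem_insert, Finset.mem_erase]
  by_cases hg : g ∈ T <;> by_cases hh : h ∈ T <;> simp [hg, hh, hne, hne.symm]
  rw [Finset.erase_insert_of_ne hne]
  rcases lt_or_gt_of_ne hne with hlt | hlt
  · rw [sgn_insert_of_lt hlt hg, sgn_erase_of_not_lt hlt.not_gt]
    ring
  · rw [sgn_insert_of_not_lt hlt.not_gt, sgn_erase_of_lt hlt hh]
    ring

theorem wedge_contract_self (g : Gen p q) (σ : PreForm p q) (T : Finset (Gen p q))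
    (n : Fin p → ℤ) (u : Prol p q) :
    wedge g (contract g σ) T n u = if g ∈ T then σ T n u else 0 := by
  by_cases hg : g ∈ T
  · simp [wedge, contract, hg, sgn_erase_of_not_lt, ← mul_assoc, sgn_mul_self]
  · simp [wedge, hg]

theorem Gen.translate_translate (K L : Fin p → ℤ) (g : Gen p q) :
    (g.translate L).translate K = g.translate (L + K) := by
  cases g <;> simp [Gen.translate, add_assoc]

theorem Gen.translate_zero (g : Gen p q) : g.translate 0 = g := by
  cases g <;> simp [Gen.translate]

theorem image_translate_translate (K L : Fin p → ℤ) (T : Finset (Gen p q)) :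
    (T.image (Gen.translate L)).image (Gen.translate K) = T.image (Gen.translate (L + K)) := by
  rw [Finset.image_image]
  exact Finset.image_congr fun g _ => Gen.translate_translate K L g

theorem image_translate_zero (T : Finset (Gen p q)) : T.image (Gen.translate 0) = T := by
  conv_rhs => rw [← Finset.image_id (s := T)]
  exact Finset.image_congr fun g _ => Gen.translate_zero g

theorem mem_image_translate_neg {K : Fin p → ℤ} {g : Gen p q} {T : Finset (Gen p q)} :
    g ∈ T.image (Gen.translate (-K)) ↔ g.translate K ∈ T := by
  rw [← (Gen.translate_strictMono (q := q) K).injective.mem_finset_image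
    (s := T.image (Gen.translate (-K))), image_translate_translate, neg_add_cancel,
    image_translate_zero]

theorem sgn_translate (K : Fin p → ℤ) (g : Gen p q) (T : Finset (Gen p q)) :
    sgn (g.translate K) (T.image (Gen.translate K)) = sgn g T := by
  have hK := Gen.translate_strictMono (q := q) K
  unfold sgn
  rw [Finset.filter_image, Finset.card_image_of_injective _ hK.injective]
  simp only [hK.lt_iff_lt]

theorem sgn_image_translate_neg (K : Fin p → ℤ) (g : Gen p q) (T : Finset (Gen p q)) :
    sgn g (T.image (Gen.translate (-K))) = sgn (g.translate K) T := by
  rw [← sgn_translate K, image_translate_translate, neg_add_cancel, image_translate_zero]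

theorem shift_zero_left (σ : PreForm p q) : shift 0 σ = σ := by
  funext T n u
  simp [shift, image_translate_zero]

theorem shift_shift (K L : Fin p → ℤ) (σ : PreForm p q) :
    shift K (shift L σ) = shift (K + L) σ := by
  funext T n u
  simp only [shift, image_translate_translate, neg_add, add_assoc, add_comm L K]

/-- No sign appears because translation preserves the order of the generators. -/
theorem shift_wedge (K : Fin p → ℤ) (g : Gen p q) (σ : PreForm p q) :
    shift K (wedge g σ) = wedge (g.translate K) (shift K σ) := by
  funext T n u
  simp only [shift, wedge, mem_image_translate_neg, sgn_image_translate_neg]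
  congr 2
  rw [Finset.image_erase (Gen.translate_strictMono _).injective, Gen.translate_translate,
    add_neg_cancel, Gen.translate_zero]

theorem shift_contract (K : Fin p → ℤ) (g : Gen p q) (σ : PreForm p q) :
    shift K (contract g σ) = contract (g.translate K) (shift K σ) := by
  funext T n u
  simp only [shift, contract, mem_image_translate_neg, sgn_image_translate_neg]
  congr 2
  rw [Finset.image_insert, Gen.translate_translate, add_neg_cancel, Gen.translate_zero]

theorem pd_wedge (c : Coord p q) (g : Gen p q) (σ : PreForm p q) :
    pd c (wedge g σ) = wedge g (pd c σ) := by
  funext T n u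
  by_cases hg : g ∈ T <;> simp [pd, wedge, hg]

theorem pd_contract (c : Coord p q) (g : Gen p q) (σ : PreForm p q) :
    pd c (contract g σ) = contract g (pd c σ) := by
  funext T n u
  by_cases hg : g ∈ T <;> simp [pd, contract, hg]

theorem pd_shift (c : Coord p q) (K : Fin p → ℤ) (σ : PreForm p q) :
    pd (c.1, c.2 + K) (shift K σ) = shift K (pd c σ) := by
  funext T n u
  simp only [pd, shift]
  congr 1
  funext t
  congr 1
  funext d
  by_cases hd : d = c
  · subst hd; simp
  · rw [Function.update_of_ne hd, Function.update_of_ne]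
    rintro h
    simp only [Prod.mk.injEq, add_left_inj] at h
    exact hd (Prod.ext h.1 h.2)

end operators

/-! ### Cartan's formula for the horizontal difference -/

section horizontal

variable {p q k l : ℕ}

theorem contract_delta_mem {σ : PreForm p q} (hσ : σ ∈ Forms p q (k + 1) l) (i : Fin p) :
    contract (Gen.delta i) σ ∈ Forms p q k l := by
  obtain ⟨h1, B, hB⟩ := hσ
  refine ⟨fun T hT => ?_, B, fun T ⟨d, hd, hdT⟩ => ?_, fun T n => ?_⟩
  · by_cases hi : Gen.delta i ∈ T
    · exact absurd (by funext n u; simp [contract, hi]) hT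
    · have h0 : σ (insert (Gen.delta i) T) ≠ 0 := fun h => hT (by
        funext n u; simp [contract, h])
      have := h1 _ h0
      rw [hdeg_insert_delta hi, vdeg_insert_delta] at this
      exact ⟨by omega, this.2⟩
  · have := hB.1 (insert (Gen.delta i) T) ⟨d, hd, by simp [hdT]⟩
    funext n u; simp [contract, this]
  · by_cases hi : Gen.delta i ∈ T
    · convert SmoothIn.zero (B := B) using 1
      funext u; simp [contract, hi]
    · obtain ⟨g, hg, hg'⟩ := hB.2 (insert (Gen.delta i) T) n
      exact ⟨fun v => sgn (Gen.delta i) T * g v, contDiff_const.mul hg,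
        fun u => by simp [contract, hi, hg']⟩

theorem hdeg_le (T : Finset (Gen p q)) : hdeg T ≤ p := by
  classical
  have : T.filter (fun g => g.isDelta = true) ⊆ Finset.univ.image Gen.delta := by
    rintro (i | c) hg
    · simp
    · exact absurd (Finset.mem_filter.1 hg).2 Bool.noConfusion
  exact (Finset.card_le_card this).trans (Finset.card_image_le.trans (by simp))

/-- There are only p distinct symbols Δ^i. Consequently every form of horizontal degree p is closed.
-/
theorem eq_zero_of_mem_forms {σ : PreForm p q} (hσ : σ ∈ Forms p q k l) (hk : p < k) : σ = 0 := by
  funext T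
  by_contra h
  have := (hσ.1 T h).1
  have := hdeg_le T
  omega

/-- The unit vector `1_i`. -/
abbrev unit (i : Fin p) : Fin p → ℤ := Pi.single i 1

theorem extDiff_apply (σ : PreForm p q) :
    extDiff σ = ∑ i, wedge (Gen.delta i) (shift (unit i) σ - σ) := rfl

/-- The horizontal difference as a linear map on formal forms. -/
def extDiffL : PreForm p q →ₗ[ℝ] PreForm p q :=
  ∑ i, wedgeL (Gen.delta i) ∘ₗ (shiftL (unit i) - LinearMap.id)

theorem extDiffL_apply (σ : PreForm p q) : extDiffL σ = extDiff σ := by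
  simp [extDiffL, extDiff_apply, wedge_sub]

theorem extDiff_add (σ τ : PreForm p q) : extDiff (σ + τ) = extDiff σ + extDiff τ := by
  simp only [← extDiffL_apply, map_add]

theorem extDiff_sub (σ τ : PreForm p q) : extDiff (σ - τ) = extDiff σ - extDiff τ := by
  simp only [← extDiffL_apply, map_sub]

theorem shift_wedge_delta (K : Fin p → ℤ) (i : Fin p) (σ : PreForm p q) :
    shift K (wedge (Gen.delta i) σ) = wedge (Gen.delta i) (shift K σ) :=
  shift_wedge K (Gen.delta i) σ

theorem shift_contract_delta (K : Fin p → ℤ) (i : Fin p) (σ : PreForm p q) :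
    shift K (contract (Gen.delta i) σ) = contract (Gen.delta i) (shift K σ) :=
  shift_contract K (Gen.delta i) σ

theorem shift_comm (K L : Fin p → ℤ) (σ : PreForm p q) :
    shift K (shift L σ) = shift L (shift K σ) := by
  rw [shift_shift, shift_shift, add_comm]

theorem shift_extDiff (K : Fin p → ℤ) (σ : PreForm p q) :
    shift K (extDiff σ) = extDiff (shift K σ) := by
  simp only [extDiff_apply, shift_sum, shift_wedge_delta, shift_sub, shift_comm K]

/-- Differences in two directions commute while Δ^i and Δ^j anticommute, so the double sum equals
its own negative. -/
theorem extDiff_extDiff (σ : PreForm p q) : extDiff (extDiff σ) = 0 := by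
  have key : ∀ i j : Fin p, wedge (Gen.delta i) (shift (unit i) (wedge (Gen.delta j)
      (shift (unit j) σ - σ)) - wedge (Gen.delta j) (shift (unit j) σ - σ)) =
      -wedge (Gen.delta j) (shift (unit j) (wedge (Gen.delta i)
      (shift (unit i) σ - σ)) - wedge (Gen.delta i) (shift (unit i) σ - σ)) := fun i j => by
    simp only [shift_wedge_delta, ← wedge_sub]
    rw [wedge_anticomm]
    congr 3
    simp only [shift_sub, shift_comm (unit j) (unit i)]
    abel
  have h : extDiff (extDiff σ) = -extDiff (extDiff σ) := by
    conv_lhs => rw [extDiff_apply, extDiff_apply]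
    conv_rhs => rw [extDiff_apply, extDiff_apply]
    simp only [shift_sum, ← Finset.sum_sub_distrib, wedge_sum]
    rw [← Finset.sum_neg_distrib]
    refine Finset.sum_comm.trans ?_
    refine Finset.sum_congr rfl fun i _ => ?_
    rw [← Finset.sum_neg_distrib]
    exact Finset.sum_congr rfl fun j _ => key j i
  exact self_eq_neg.1 h

/-- Cartan's formula for the horizontal difference and an operator `h` that commutes with the
exterior algebra in the `Δ^j` and with the shifts in the directions other than `i`. -/
theorem extDiff_contract_add (h : PreForm p q →ₗ[ℝ] PreForm p q) (i : Fin p)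
    (hw : ∀ j σ, h (wedge (Gen.delta j) σ) = wedge (Gen.delta j) (h σ))
    (hs : ∀ j, j ≠ i → ∀ σ, h (shift (unit j) σ) = shift (unit j) (h σ)) (σ : PreForm p q) :
    extDiff (contract (Gen.delta i) (h σ)) + contract (Gen.delta i) (h (extDiff σ)) =
      wedge (Gen.delta i) (contract (Gen.delta i) (shift (unit i) (h σ) - h σ)) +
      contract (Gen.delta i) (wedge (Gen.delta i) (h (shift (unit i) σ - σ))) := by
  simp only [extDiff_apply, map_sum, contract_sum, ← Finset.sum_add_distrib, hw,
    shift_contract_delta, ← contract_sub]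
  -- For j ≠ i, ι_i anticommutes with Δ^j and `h` commutes with the difference in direction j, so
  -- the two contributions cancel.
  rw [Finset.sum_eq_single i]
  · intro j _ hj
    rw [contract_wedge_of_ne (g := Gen.delta i) (h := Gen.delta j) (by simpa using hj.symm),
      map_sub, hs j hj]
    abel
  · simp

theorem extDiff_contract (i : Fin p) (σ : PreForm p q) :
    extDiff (contract (Gen.delta i) σ) + contract (Gen.delta i) (extDiff σ) =
      shift (unit i) σ - σ := by
  have := extDiff_contract_add LinearMap.id i (fun _ _ => rfl) (fun _ _ _ => rfl) σ
  simp only [LinearMap.id_apply] at this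
  rw [this, add_comm, contract_wedge_self]

/-- A subset of `ℤ^p` that contains the unit vectors and is a subgroup is everything. -/
theorem addSubgroup_eq_top (G : AddSubgroup (Fin p → ℤ)) (h : ∀ i, unit i ∈ G)
    (K : Fin p → ℤ) : K ∈ G := by
  have : K = ∑ i, K i • unit i := by
    funext j
    simp [Finset.sum_apply, Pi.single_apply]
  rw [this]
  exact G.sum_mem fun i _ => G.zsmul_mem (h i) _

/-- Unit shifts act trivially on cohomology by Cartan's formula. The K with this property form a
subgroup, because S_{K+L} σ - σ = S_K (S_L σ - σ) + (S_K σ - σ) and shifts commute with d_h. -/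
theorem shift_sub_self_exact {σ : PreForm p q} (hσ : σ ∈ Forms p q (k + 1) l)
    (hd : extDiff σ = 0) (K : Fin p → ℤ) :
    ∃ τ ∈ Forms p q k l, shift K σ - σ = extDiff τ := by
  let G : AddSubgroup (Fin p → ℤ) :=
    { carrier := {K | ∃ τ ∈ Forms p q k l, shift K σ - σ = extDiff τ}
      zero_mem' := ⟨0, zero_mem _, by simp [shift_zero_left, ← extDiffL_apply]⟩
      add_mem' := by
        rintro K L ⟨τ, hτ, h⟩ ⟨ρ, hρ, h'⟩
        refine ⟨shift K ρ + τ, add_mem (shift_mem hρ K) hτ, ?_⟩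
        rw [extDiff_add, ← shift_extDiff, ← h, ← h', shift_sub, shift_shift]
        abel
      neg_mem' := by
        rintro K ⟨τ, hτ, h⟩
        refine ⟨-shift (-K) τ, neg_mem (shift_mem hτ _), ?_⟩
        rw [← extDiffL_apply, map_neg, extDiffL_apply, ← shift_extDiff, ← h, shift_sub,
          shift_shift, neg_add_cancel, shift_zero_left]
        abel }
  refine addSubgroup_eq_top G (fun i => ⟨contract (Gen.delta i) σ, contract_delta_mem hσ i, ?_⟩) K
  rw [← extDiff_contract, hd, contract_zero, add_zero]

end horizontal

/-! ### The interior Euler operator modulo d_h-exact forms -/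

section euler

variable {p q k l : ℕ}

/-- Each summand keeps exactly the monomials containing du_c. A monomial of σ has l vertical
factors, all with labels in B, so it is counted l times. -/
theorem sum_wedge_contract {B : Finset (Coord p q)} {σ : PreForm p q} (hB : IsLocal B σ)
    (hσ : σ ∈ Forms p q k l) :
    ∑ c ∈ B, wedge (Gen.du c) (contract (Gen.du c) σ) = (l : ℝ) • σ := by
  classical
  funext T n u
  simp only [Finset.sum_apply, wedge_contract_self, Pi.smul_apply, smul_eq_mul]
  by_cases hT : σ T = 0
  · simp [hT]
  rw [← Finset.sum_filter, Finset.sum_const, nsmul_eq_mul]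
  congr 2
  rw [← (hσ.1 T hT).2, vdeg]
  have hinj : Function.Injective (Gen.du : Coord p q → Gen p q) := fun a b h => by simpa using h
  rw [← Finset.card_image_of_injective _ hinj]
  congr 1
  ext g
  simp only [Finset.mem_image, Finset.mem_filter]
  constructor
  · rintro ⟨c, ⟨_, hc⟩, rfl⟩
    exact ⟨hc, rfl⟩
  · rcases g with i | c
    · simp [Gen.isDelta]
    · rintro ⟨hc, -⟩
      refine ⟨c, ⟨?_, hc⟩, rfl⟩
      by_contra h
      exact hT (hB.1 T ⟨c, h, hc⟩)

/-- I^Δ σ arises from σ = (1/(l+1)) ∑ du_c ∧ ι_c σ by shifting each summand by -J, and in top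
horizontal degree such a shift changes a form only by an exact one. -/
theorem sub_interiorEuler_exact {m : ℕ} {σ : PreForm (m + 1) q}
    (hσ : σ ∈ Forms (m + 1) q (m + 1) (l + 1)) :
    ∃ τ ∈ Forms (m + 1) q m (l + 1), σ - interiorEuler (l + 1) σ = extDiff τ := by
  obtain ⟨B, hB⟩ := hσ.2
  have h0 : ((l + 1 : ℕ) : ℝ) ≠ 0 := by positivity
  have h1 : ∀ c, wedge (Gen.du c) (contract (Gen.du c) σ) ∈ Forms (m + 1) q (m + 1) (l + 1) :=
    fun c => wedge_du_mem (contract_du_mem hσ c) c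
  choose τ hτ hτ' using fun c : Coord (m + 1) q => shift_sub_self_exact (h1 c)
    (eq_zero_of_mem_forms (extDiff_mem (h1 c)) (by omega)) (-c.2)
  -- `τ c` is a primitive of the shifted summand minus the summand; the factor normalizes the count
  -- l + 1, and the sign reverses the difference.
  refine ⟨-(1 / ((l + 1 : ℕ) : ℝ)) • ∑ c ∈ B, τ c,
    Submodule.smul_mem _ _ (Submodule.sum_mem _ fun c _ => hτ c), ?_⟩
  rw [← extDiffL_apply, map_smul, map_sum]
  simp only [extDiffL_apply, ← hτ', Finset.sum_sub_distrib, sum_wedge_contract hB hσ]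
  rw [interiorEuler_eq_sum hB, neg_smul, smul_sub, smul_smul, one_div, inv_mul_cancel₀ h0, one_smul,
    neg_sub]
  congr 3
  funext c
  rw [shift_wedge]
  simp [Gen.translate]

/-- Translating the summation labels by K turns S_{-J} into S_{-J-K}, which undoes S_K. -/
theorem interiorEuler_shift (K : Fin p → ℤ) (σ : PreForm p q) :
    interiorEuler l (shift K σ) = interiorEuler l σ := by
  funext T n u
  unfold interiorEuler
  congr 1
  let e : Coord p q ≃ Coord p q := Equiv.prodCongr (Equiv.refl _) (Equiv.addRight K)
  rw [← finsum_comp_equiv e]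
  refine finsum_congr fun c => ?_
  have : shift K (contract (Gen.du c) σ) = contract (Gen.du (e c)) (shift K σ) :=
    shift_contract K (Gen.du c) σ
  rw [← this, shift_shift]
  simp [e]

end euler

/-! ### The kernel of I^Δ on the spaces of forms -/

section linear

variable (p q k l : ℕ)

/-- The shift on `Ω^{k,l}`. -/
def shiftF (K : Fin p → ℤ) : Forms p q k l →ₗ[ℝ] Forms p q k l where
  toFun σ := ⟨shift K σ, shift_mem σ.2 K⟩
  map_add' _ _ := rfl
  map_smul' _ _ := rfl

/-- The exterior product with `Δ^i` on `Ω^{k,l}`. -/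
def wedgeF (i : Fin p) : Forms p q k l →ₗ[ℝ] Forms p q (k + 1) l where
  toFun σ := ⟨wedge (Gen.delta i) σ, wedge_delta_mem σ.2 i⟩
  map_add' _ _ := Subtype.ext (wedge_add _ _ _)
  map_smul' _ _ := Subtype.ext (wedge_smul _ _ _)

variable {p q k l}

theorem dH_apply (σ : Forms p q k l) :
    dH p q k l σ = ∑ i, wedgeF p q k l i (shiftF p q k l (unit i) σ - σ) := by
  refine Subtype.ext ?_
  rw [AddSubmonoidClass.coe_finsetSum]
  rfl

theorem dH_dH (σ : Forms p q k l) : dH p q (k + 1) l (dH p q k l σ) = 0 :=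
  Subtype.ext (extDiff_extDiff _)

/-- Since Δ^i is shift invariant, d_h σ is a sum of differences S_i ω - ω, and I^Δ does not see
shifts. -/
theorem euler_dH {m : ℕ} (σ : Forms (m + 1) q m l) :
    euler (m + 1) q l (dH (m + 1) q m l σ) = 0 := by
  have hs : ∀ (K) (τ : Forms (m + 1) q (m + 1) l),
      euler (m + 1) q l (shiftF (m + 1) q (m + 1) l K τ) = euler (m + 1) q l τ := fun K τ =>
    Subtype.ext (interiorEuler_shift K _)
  have hw : ∀ i K, wedgeF (m + 1) q m l i (shiftF (m + 1) q m l K σ) =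
      shiftF (m + 1) q (m + 1) l K (wedgeF (m + 1) q m l i σ) := fun i K =>
    Subtype.ext (shift_wedge_delta _ _ _).symm
  simp [dH_apply, map_sum, map_sub, hw, hs]

theorem exists_sub_euler_eq_dH {m : ℕ} (σ : Forms (m + 1) q (m + 1) (l + 1)) :
    ∃ τ, σ - euler (m + 1) q (l + 1) σ = dH (m + 1) q m (l + 1) τ := by
  obtain ⟨τ, hτ, h⟩ := sub_interiorEuler_exact σ.2
  exact ⟨⟨τ, hτ⟩, Subtype.ext h⟩

end linear

/-! ### Anticommutation of d_v and h_v with d_h -/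

section equivariance

variable {p q k l : ℕ}

/-- Translation of the labels of the coordinates. -/
def coordShift (K : Fin p → ℤ) : Coord p q ≃ Coord p q :=
  Equiv.prodCongr (Equiv.refl _) (Equiv.addRight K)

theorem coordShift_apply (K : Fin p → ℤ) (c : Coord p q) : coordShift K c = (c.1, c.2 + K) := rfl

theorem vertDeriv_shift (K : Fin p → ℤ) (σ : PreForm p q) :
    vertDeriv (shift K σ) = shift K (vertDeriv σ) := by
  funext T n u
  rw [vertDeriv, ← finsum_comp_equiv (coordShift K)]
  simp only [coordShift_apply, pd_shift]
  exact finsum_congr fun c => (congrFun (congrFun (congrFun (shift_wedge K (Gen.du c) (pd c σ)) T)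
    n) u).symm

theorem vertDeriv_wedge_delta (i : Fin p) (σ : PreForm p q) :
    vertDeriv (wedge (Gen.delta i) σ) = -wedge (Gen.delta i) (vertDeriv σ) := by
  funext T n u
  simp only [vertDeriv, pd_wedge]
  simp only [fun c : Coord p q => wedge_anticomm (Gen.du c) (Gen.delta i) (pd c σ), Pi.neg_apply,
    finsum_neg_distrib]
  congr 1
  by_cases hi : Gen.delta i ∈ T
  · rw [wedge, if_pos hi, vertDeriv, ← smul_eq_mul, smul_finsum]
    exact finsum_congr fun c => by rw [wedge, if_pos hi, smul_eq_mul]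
  · rw [wedge, if_neg hi]
    simp [wedge, hi]

/-- The radial field is invariant under relabelling, since coordinates and differentials are
translated together. -/
theorem radialContract_shift (K : Fin p → ℤ) (σ : PreForm p q) :
    radialContract (shift K σ) = shift K (radialContract σ) := by
  funext T n u
  rw [radialContract, ← finsum_comp_equiv (coordShift K)]
  refine finsum_congr fun c => ?_
  rw [coordShift_apply]
  congr 1
  exact (congrFun (congrFun (congrFun (shift_contract K (Gen.du c) σ) T) n) u).symm

theorem radialContract_wedge_delta (i : Fin p) (σ : PreForm p q) :
    radialContract (wedge (Gen.delta i) σ) = -wedge (Gen.delta i) (radialContract σ) := by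
  funext T n u
  simp only [radialContract]
  simp only [fun c : Coord p q => contract_wedge_of_ne (g := Gen.du c) (h := Gen.delta i)
    (by simp) σ, Pi.neg_apply, mul_neg, finsum_neg_distrib]
  congr 1
  by_cases hi : Gen.delta i ∈ T
  · rw [wedge, if_pos hi, radialContract, ← smul_eq_mul, smul_finsum]
    exact finsum_congr fun c => by rw [wedge, if_pos hi, smul_eq_mul, mul_left_comm]
  · simp [wedge, hi]

theorem vertHomotopy_shift (K : Fin p → ℤ) (σ : PreForm p q) :
    vertHomotopy (shift K σ) = shift K (vertHomotopy σ) := by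
  funext T n u
  simp only [vertHomotopy, shift, dilate, vdeg_translate]
  rw [radialContract_shift]
  rfl

theorem vertHomotopy_wedge_delta (i : Fin p) (σ : PreForm p q) :
    vertHomotopy (wedge (Gen.delta i) σ) = -wedge (Gen.delta i) (vertHomotopy σ) := by
  funext T n u
  simp only [vertHomotopy, dilate, radialContract_wedge_delta, Pi.neg_apply, mul_neg,
    intervalIntegral.integral_neg]
  congr 1
  by_cases hi : Gen.delta i ∈ T
  · have hT : vdeg T = vdeg (T.erase (Gen.delta i)) := by
      conv_lhs => rw [← Finset.insert_erase hi, vdeg_insert_delta]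
    simp only [wedge, hi, if_true, vertHomotopy, dilate]
    rw [← intervalIntegral.integral_const_mul]
    refine intervalIntegral.integral_congr fun s _ => ?_
    simp only [hT]
    ring
  · simp [wedge, hi]

/-- d_v commutes with shifts and passes each Δ^i with a sign. Together with `hV_dH` this lets d_v
and h_v act modulo d_h-exact forms. -/
theorem dV_dH (σ : Forms p q k l) :
    dV p q (k + 1) l (dH p q k l σ) = -dH p q k (l + 1) (dV p q k l σ) := by
  have hs : ∀ K, dV p q k l (shiftF p q k l K σ) = shiftF p q k (l + 1) K (dV p q k l σ) :=
    fun K => Subtype.ext (vertDeriv_shift K _)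
  have hw : ∀ i (τ : Forms p q k l), dV p q (k + 1) l (wedgeF p q k l i τ) =
      -wedgeF p q k (l + 1) i (dV p q k l τ) := fun i τ => Subtype.ext (vertDeriv_wedge_delta i _)
  simp [dH_apply, map_sum, map_sub, hw, hs, neg_add_eq_sub]

theorem hV_dH (σ : Forms p q k (l + 1)) :
    hV p q (k + 1) l (dH p q k (l + 1) σ) = -dH p q k l (hV p q k l σ) := by
  have hs : ∀ K, hV p q k l (shiftF p q k (l + 1) K σ) = shiftF p q k l K (hV p q k l σ) :=
    fun K => Subtype.ext (vertHomotopy_shift K _)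
  have hw : ∀ i (τ : Forms p q k (l + 1)), hV p q (k + 1) l (wedgeF p q k (l + 1) i τ) =
      -wedgeF p q k l i (hV p q k l τ) := fun i τ => Subtype.ext (vertHomotopy_wedge_delta i _)
  simp [dH_apply, map_sum, map_sub, hw, hs, neg_add_eq_sub]

end equivariance

/-! ### The vertical Poincaré lemma -/

section vertical

variable {p q k l : ℕ} {B : Finset (Coord p q)}

/-- The restriction to `B` of the unit vector of a coordinate. -/
def coordVec (B : Finset (Coord p q)) (c : Coord p q) : B → ℝ := fun b => if (b : _) = c then 1 else 0

theorem hasDerivAt_update_apply (u : Prol p q) (c d : Coord p q) (t : ℝ) :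
    HasDerivAt (fun t => Function.update u c t d) (if d = c then 1 else 0) t := by
  by_cases h : d = c
  · subst h
    simpa using hasDerivAt_id' t
  · simpa [h, Function.update_of_ne] using hasDerivAt_const t (u d)

/-- Reduces calculus on the infinite product to finite dimensions. For c outside B the vector
`coordVec B c` is zero, so no case distinction is needed. -/
theorem pd_eq_fderiv {σ : PreForm p q} {T : Finset (Gen p q)} {n : Fin p → ℤ} {g : (B → ℝ) → ℝ}
    (hg : Differentiable ℝ g) (hσ : ∀ u, σ T n u = g fun b => u b) (c : Coord p q) (u : Prol p q) :
    pd c σ T n u = fderiv ℝ g (fun b => u b) (coordVec B c) := by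
  have h1 : HasDerivAt (fun t => fun b : B => Function.update u c t b) (coordVec B c) (u c) :=
    hasDerivAt_pi.2 fun b => hasDerivAt_update_apply u c b (u c)
  have h2 : HasFDerivAt g (fderiv ℝ g fun b => u b) (fun b : B => Function.update u c (u c) b) := by
    rw [Function.update_eq_self]
    exact (hg _).hasFDerivAt
  simp only [pd, hσ]
  exact (h2.comp_hasDerivAt (u c) h1).deriv

theorem pd_comm {σ : PreForm p q} (hσ : IsLocal B σ) (c d : Coord p q) :
    pd c (pd d σ) = pd d (pd c σ) := by
  funext T n u
  obtain ⟨g, hg, hg'⟩ := hσ.2 T n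
  have h1 : ContDiff ℝ ∞ (fderiv ℝ g) := hg.fderiv_right (by simp)
  have h2 : ∀ d, ContDiff ℝ ∞ fun v => fderiv ℝ g v (coordVec B d) := fun d =>
    h1.clm_apply contDiff_const
  have key : ∀ c d, pd c (pd d σ) T n u =
      fderiv ℝ (fderiv ℝ g) (fun b => u b) (coordVec B c) (coordVec B d) := fun c d => by
    rw [pd_eq_fderiv ((h2 d).differentiable (by simp))
      (fun u => pd_eq_fderiv (hg.differentiable (by simp)) hg' d u)]
    rw [fderiv_clm_apply (h1.differentiable (by simp) _) (by fun_prop)]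
    simp
  rw [key, key]
  have := (hg.contDiffAt (x := fun b : B => u b)).isSymmSndFDerivAt
    (by rw [minSmoothness_of_isRCLikeNormedField]; exact WithTop.coe_le_coe.2 le_top)
  exact this _ _

theorem hasDerivAt_smul {σ : PreForm p q} (hσ : IsLocal B σ) (T : Finset (Gen p q))
    (n : Fin p → ℤ) (u : Prol p q) (s : ℝ) : HasDerivAt (fun s : ℝ => σ T n (s • u))
      (∑ c ∈ B, u c * pd c σ T n (s • u)) s := by
  obtain ⟨g, hg, hg'⟩ := hσ.2 T n
  have hd := hg.differentiable (by simp)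
  have h1 : HasDerivAt (fun s : ℝ => fun b : B => (s • u) b) (fun b : B => u b) s :=
    hasDerivAt_pi.2 fun b => by simpa using (hasDerivAt_id s).mul_const (u b)
  have h2 := (hd fun b => (s • u) b).hasFDerivAt.comp_hasDerivAt s h1
  simp only [hg']
  refine HasDerivAt.congr_deriv h2 ?_
  simp only [pd_eq_fderiv hd hg']
  have : (fun b : B => u b) = ∑ c : B, u c • coordVec B c := by
    funext b
    rw [Finset.sum_apply, Finset.sum_eq_single b]
    · simp [coordVec]
    · intro c _ hc
      simp [coordVec, hc.symm]
    · simp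
  conv_lhs => rw [this, map_sum]
  rw [← Finset.sum_coe_sort B]
  simp

theorem pd_add_of_mem {k' l' : ℕ} {σ τ : PreForm p q} (hσ : σ ∈ Forms p q k l)
    (hτ : τ ∈ Forms p q k' l') (c : Coord p q) : pd c (σ + τ) = pd c σ + pd c τ := by
  obtain ⟨_, hσ⟩ := hσ.2
  obtain ⟨_, hτ⟩ := hτ.2
  funext T n u
  exact ((hσ.hasDerivAt c T n u).add (hτ.hasDerivAt c T n u)).deriv

theorem pd_sum_of_mem {ι : Type*} (s : Finset ι) {σ : ι → PreForm p q}
    (hσ : ∀ i, σ i ∈ Forms p q k l) (c : Coord p q) :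
    pd c (∑ i ∈ s, σ i) = ∑ i ∈ s, pd c (σ i) := by
  classical
  induction s using Finset.induction_on with
  | empty => funext T n u; simp [pd]
  | insert i s hi ih =>
    rw [Finset.sum_insert hi, Finset.sum_insert hi,
      pd_add_of_mem (hσ i) (Submodule.sum_mem _ fun i _ => hσ i), ih]

theorem exists_isLocal_triple {k' l' k'' l'' : ℕ} {σ τ ρ : PreForm p q} (hσ : σ ∈ Forms p q k l)
    (hτ : τ ∈ Forms p q k' l') (hρ : ρ ∈ Forms p q k'' l'') :
    ∃ B, IsLocal B σ ∧ IsLocal B τ ∧ IsLocal B ρ := by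
  classical
  obtain ⟨B, hB⟩ := hσ.2
  obtain ⟨C, hC⟩ := hτ.2
  obtain ⟨D, hD⟩ := hρ.2
  exact ⟨B ∪ (C ∪ D), hB.mono Finset.subset_union_left,
    hC.mono (Finset.subset_union_left.trans Finset.subset_union_right),
    hD.mono (Finset.subset_union_right.trans Finset.subset_union_right)⟩

theorem vertDeriv_vertDeriv {σ : PreForm p q} (hσ : σ ∈ Forms p q k l) :
    vertDeriv (vertDeriv σ) = 0 := by
  obtain ⟨B, hB, hB', -⟩ := exists_isLocal_triple hσ (vertDeriv_mem hσ) hσ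
  have key : vertDeriv (vertDeriv σ) =
      ∑ c ∈ B, ∑ d ∈ B, wedge (Gen.du c) (wedge (Gen.du d) (pd c (pd d σ))) := by
    rw [vertDeriv_eq_sum hB', vertDeriv_eq_sum hB]
    simp only [pd_sum_of_mem B (fun d => wedge_du_mem (pd_mem hσ d) d), wedge_sum, pd_wedge]
  refine self_eq_neg.1 ?_
  conv_lhs => rw [key, Finset.sum_comm]
  rw [key, ← Finset.sum_neg_distrib]
  refine Finset.sum_congr rfl fun c _ => ?_
  rw [← Finset.sum_neg_distrib]
  refine Finset.sum_congr rfl fun d _ => ?_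
  rw [wedge_anticomm, pd_comm hB]

/-- The weighted radial average `∫_0^1 s^m σ(n, s u) ds` of all coefficients. -/
def radialAvg (m : ℕ) (σ : PreForm p q) : PreForm p q := fun T n u =>
  ∫ s in (0 : ℝ)..1, s ^ m * σ T n (s • u)

theorem IsLocal.continuous_smul {σ : PreForm p q} (hσ : IsLocal B σ) (T : Finset (Gen p q))
    (n : Fin p → ℤ) (u : Prol p q) : Continuous fun s : ℝ => σ T n (s • u) :=
  continuous_iff_continuousAt.2 fun s => (hasDerivAt_smul hσ T n u s).continuousAt

theorem radialAvg_integrable {σ : PreForm p q} (hσ : σ ∈ Forms p q k l) (m : ℕ)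
    (T : Finset (Gen p q)) (n : Fin p → ℤ) (u : Prol p q) :
    IntervalIntegrable (fun s : ℝ => s ^ m * σ T n (s • u)) MeasureTheory.volume 0 1 := by
  obtain ⟨B, hB⟩ := hσ.2
  exact ((continuous_id.pow m).mul (hB.continuous_smul T n u)).intervalIntegrable _ _

theorem radialAvg_add (m : ℕ) {σ τ : PreForm p q} (hσ : σ ∈ Forms p q k l)
    (hτ : τ ∈ Forms p q k l) : radialAvg m (σ + τ) = radialAvg m σ + radialAvg m τ := by
  funext T n u
  simp only [radialAvg, Pi.add_apply, mul_add]
  exact intervalIntegral.integral_add (radialAvg_integrable hσ m T n u)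
    (radialAvg_integrable hτ m T n u)

theorem radialAvg_sum {ι : Type*} (m : ℕ) (s : Finset ι) {σ : ι → PreForm p q}
    (hσ : ∀ i, σ i ∈ Forms p q k l) :
    radialAvg m (∑ i ∈ s, σ i) = ∑ i ∈ s, radialAvg m (σ i) := by
  classical
  induction s using Finset.induction_on with
  | empty => funext T n u; simp [radialAvg]
  | insert i s hi ih =>
    rw [Finset.sum_insert hi, Finset.sum_insert hi,
      radialAvg_add m (hσ i) (Submodule.sum_mem _ fun i _ => hσ i), ih]

theorem radialAvg_smul (m : ℕ) (a : ℝ) (σ : PreForm p q) :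
    radialAvg m (a • σ) = a • radialAvg m σ := by
  funext T n u
  simp [radialAvg, mul_left_comm _ a]

theorem radialAvg_wedge (m : ℕ) (g : Gen p q) (σ : PreForm p q) :
    radialAvg m (wedge g σ) = wedge g (radialAvg m σ) := by
  funext T n u
  by_cases hg : g ∈ T <;> simp [radialAvg, wedge, hg, mul_left_comm _ (sgn g T)]

theorem hasDerivAt_param {f : ℝ → ℝ → ℝ} (hf : ContDiff ℝ ∞ (fun x : ℝ × ℝ => f x.1 x.2))
    (t : ℝ) : HasDerivAt (fun t => ∫ s in (0 : ℝ)..1, f s t)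
      (∫ s in (0 : ℝ)..1, deriv (f s) t) t := by
  have hc : Continuous fun s => fderiv ℝ (f s) t :=
    ContDiff.continuous (𝕜 := ℝ) (n := ∞) <|
      ContDiff.fderiv (f := f) (g := fun _ => t) (m := ∞) (n := ∞) hf contDiff_const (by simp)
  have := (hasFDerivAt_param hf t).hasDerivAt
  rwa [ContinuousLinearMap.intervalIntegral_apply (hc.intervalIntegrable _ _)] at this

theorem smul_update (s t : ℝ) (u : Prol p q) (c : Coord p q) :
    s • Function.update u c t = Function.update (s • u) c (s * t) := by
  funext d
  by_cases h : d = c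
  · subst h; simp
  · simp [h, Function.update_of_ne]

/-- Differentiation under the integral; the chain rule through s • u supplies the extra factor s
that raises the weight. -/
theorem hasDerivAt_radialAvg (m : ℕ) {σ : PreForm p q} (hσ : IsLocal B σ) (c : Coord p q)
    (T : Finset (Gen p q)) (n : Fin p → ℤ) (u : Prol p q) :
    HasDerivAt (fun t => radialAvg m σ T n (Function.update u c t))
      (radialAvg (m + 1) (pd c σ) T n u) (u c) := by
  have hf : ContDiff ℝ ∞ fun x : ℝ × ℝ => x.1 ^ m * σ T n (x.1 • Function.update u c x.2) := by
    obtain ⟨g, hg, hg'⟩ := hσ.2 T n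
    simp only [hg']
    refine (contDiff_fst.pow m).mul (hg.comp (contDiff_pi.2 fun b => ?_))
    by_cases hb : (b : Coord p q) = c
    · simp only [Pi.smul_apply, hb, Function.update_self]
      exact contDiff_fst.mul contDiff_snd
    · simp only [Pi.smul_apply, Function.update_of_ne hb]
      exact contDiff_fst.mul contDiff_const
  refine (hasDerivAt_param (f := fun s t => s ^ m * σ T n (s • Function.update u c t)) hf
    (u c)).congr_deriv ?_
  refine intervalIntegral.integral_congr fun s _ => ?_
  have h1 : HasDerivAt (fun t => s * t) s (u c) := by
    simpa using (hasDerivAt_id (u c)).const_mul s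
  have h2 := (hσ.hasDerivAt c T n (s • u)).comp (u c) h1
  have h3 : HasDerivAt (fun t => s ^ m * σ T n (s • Function.update u c t))
      (s ^ m * (pd c σ T n (s • u) * s)) (u c) := by
    simp only [smul_update]
    exact h2.const_mul (s ^ m)
  exact h3.deriv.trans (by ring)

theorem vertHomotopy_eq_sum {σ : PreForm p q} (hσ : σ ∈ Forms p q k (l + 1)) (hB : IsLocal B σ)
    (T : Finset (Gen p q)) (n : Fin p → ℤ) (u : Prol p q) :
    vertHomotopy σ T n u = ∑ c ∈ B, u c * radialAvg l (contract (Gen.du c) σ) T n u := by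
  rw [vertHomotopy_eq hσ hB]
  simp only [radialAvg, ← intervalIntegral.integral_const_mul, Finset.mul_sum,
    mul_left_comm _ (u _)]
  exact intervalIntegral.integral_finsetSum fun c _ =>
    (radialAvg_integrable (contract_du_mem hσ c) l T n u).const_mul (u c)

theorem pd_vertHomotopy {σ : PreForm p q} (hσ : σ ∈ Forms p q k (l + 1)) (hB : IsLocal B σ)
    {d : Coord p q} (hd : d ∈ B) (T : Finset (Gen p q)) (n : Fin p → ℤ) (u : Prol p q) :
    pd d (vertHomotopy σ) T n u = radialAvg l (contract (Gen.du d) σ) T n u +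
      ∑ c ∈ B, u c * radialAvg (l + 1) (contract (Gen.du c) (pd d σ)) T n u := by
  classical
  have h : ∀ c, HasDerivAt (fun t => Function.update u d t c *
      radialAvg l (contract (Gen.du c) σ) T n (Function.update u d t))
      ((if c = d then 1 else 0) * radialAvg l (contract (Gen.du c) σ) T n u +
        u c * radialAvg (l + 1) (contract (Gen.du c) (pd d σ)) T n u) (u d) := fun c => by
    obtain ⟨C, hC⟩ := (contract_du_mem hσ c).2
    have h1 := (hasDerivAt_update_apply u d c (u d)).fun_mul (hasDerivAt_radialAvg l hC d T n u)
    simpa only [Function.update_eq_self, pd_contract] using h1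
  have := (HasDerivAt.fun_sum fun c (_ : c ∈ B) => h c).deriv
  simp only [pd, vertHomotopy_eq_sum hσ hB]
  rw [this, Finset.sum_add_distrib]
  congr 1
  simp [hd]

/-- The fundamental theorem of calculus for s^(m+1) σ(n, s u) on [0,1]. The boundary term at 0
vanishes because the exponent is positive. -/
theorem integral_radial {σ : PreForm p q} (hσ : σ ∈ Forms p q k l) (hB : IsLocal B σ) (m : ℕ)
    (T : Finset (Gen p q)) (n : Fin p → ℤ) (u : Prol p q) :
    ((m + 1 : ℕ) : ℝ) * radialAvg m σ T n u + ∑ c ∈ B, u c * radialAvg (m + 1) (pd c σ) T n u =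
      σ T n u := by
  have hd : ∀ s : ℝ, HasDerivAt (fun s : ℝ => s ^ (m + 1) * σ T n (s • u))
      (((m + 1 : ℕ) : ℝ) * (s ^ m * σ T n (s • u)) +
        ∑ c ∈ B, u c * (s ^ (m + 1) * pd c σ T n (s • u))) s := fun s => by
    refine ((hasDerivAt_pow (m + 1) s).fun_mul (hasDerivAt_smul hB T n u s)).congr_deriv ?_
    rw [Finset.mul_sum, add_tsub_cancel_right]
    congr 1
    · ring
    · exact Finset.sum_congr rfl fun c _ => by ring
  have hi1 := (radialAvg_integrable hσ m T n u).const_mul ((m + 1 : ℕ) : ℝ)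
  have hi2 : ∀ c ∈ B, IntervalIntegrable (fun s : ℝ => u c * (s ^ (m + 1) * pd c σ T n (s • u)))
      MeasureTheory.volume 0 1 := fun c _ =>
    (radialAvg_integrable (pd_mem hσ c) (m + 1) T n u).const_mul (u c)
  have hi3 : IntervalIntegrable (fun s : ℝ => ∑ c ∈ B, u c * (s ^ (m + 1) * pd c σ T n (s • u)))
      MeasureTheory.volume 0 1 := by
    simpa [Finset.sum_fn] using IntervalIntegrable.sum B hi2
  have := intervalIntegral.integral_eq_sub_of_hasDerivAt (fun s _ => hd s) (hi1.add hi3)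
  rw [intervalIntegral.integral_add hi1 hi3, intervalIntegral.integral_finsetSum hi2] at this
  simpa [radialAvg] using this

/-- The analogue with exponent 0: the boundary term σ(n,0) survives, which is the obstruction in
vertical degree zero. -/
theorem integral_radial_zero {σ : PreForm p q} (hσ : σ ∈ Forms p q k l) (hB : IsLocal B σ)
    (T : Finset (Gen p q)) (n : Fin p → ℤ) (u : Prol p q) :
    ∑ c ∈ B, u c * radialAvg 0 (pd c σ) T n u = σ T n u - σ T n 0 := by
  have hi2 : ∀ c ∈ B, IntervalIntegrable (fun s : ℝ => u c * pd c σ T n (s • u))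
      MeasureTheory.volume 0 1 := fun c _ => by
    simpa using (radialAvg_integrable (pd_mem hσ c) 0 T n u).const_mul (u c)
  have hi3 : IntervalIntegrable (fun s : ℝ => ∑ c ∈ B, u c * pd c σ T n (s • u))
      MeasureTheory.volume 0 1 := by
    simpa [Finset.sum_fn] using IntervalIntegrable.sum B hi2
  have := intervalIntegral.integral_eq_sub_of_hasDerivAt
    (fun s _ => hasDerivAt_smul hB T n u s) hi3
  rw [intervalIntegral.integral_finsetSum hi2] at this
  simpa [radialAvg] using this

theorem vertHomotopy_vertDeriv {σ : PreForm p q} (hσ : σ ∈ Forms p q k l) (hB : IsLocal B σ)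
    (hB' : IsLocal B (vertDeriv σ)) (T : Finset (Gen p q)) (n : Fin p → ℤ) (u : Prol p q) :
    vertHomotopy (vertDeriv σ) T n u = ∑ c ∈ B, u c * radialAvg l (pd c σ) T n u -
      ∑ d ∈ B, ∑ c ∈ B,
        u c * wedge (Gen.du d) (radialAvg l (contract (Gen.du c) (pd d σ))) T n u := by
  classical
  rw [vertHomotopy_eq_sum (vertDeriv_mem hσ) hB', Finset.sum_comm, ← Finset.sum_sub_distrib]
  refine Finset.sum_congr rfl fun c hc => ?_
  rw [← Finset.mul_sum, ← mul_sub]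
  congr 1
  -- Moving ι_c past du_d costs only a sign unless d = c, where it also releases ∂_c σ.
  have h1 : contract (Gen.du c) (vertDeriv σ) +
      ∑ d ∈ B, wedge (Gen.du d) (contract (Gen.du c) (pd d σ)) = pd c σ := by
    rw [vertDeriv_eq_sum hB, contract_sum, ← Finset.sum_add_distrib, Finset.sum_eq_single c]
    · exact contract_wedge_self _ _
    · intro d _ hd
      rw [contract_wedge_of_ne (by simpa using hd.symm), neg_add_cancel]
    · exact fun h => absurd hc h
  -- In vertical degree zero all contractions vanish; for positive degree `contract_du_mem` applies.
  cases l with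
  | zero =>
    have h0 : ∀ d, contract (Gen.du c) (pd d σ) = 0 := fun d => by
      funext T n u
      by_cases hcT : Gen.du c ∈ T
      · simp [contract, hcT]
      have : pd d σ (insert (Gen.du c) T) = 0 := by
        by_contra h
        have := ((pd_mem hσ d).1 _ h).2
        rw [vdeg_insert_du hcT] at this
        omega
      simp [contract, this]
    simp only [h0, wedge_zero, Finset.sum_const_zero, add_zero] at h1 ⊢
    have hz : radialAvg 0 (0 : PreForm p q) = 0 := by funext T n u; simp [radialAvg]
    simp [h1, hz, wedge_zero]
  | succ l =>
    have hw : ∀ d, wedge (Gen.du d) (contract (Gen.du c) (pd d σ)) ∈ Forms p q k (l + 1) :=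
      fun d => wedge_du_mem (contract_du_mem (pd_mem hσ d) c) d
    rw [← h1, radialAvg_add _ (contract_du_mem (vertDeriv_mem hσ) c)
      (Submodule.sum_mem _ fun d _ => hw d), radialAvg_sum _ _ hw]
    simp [radialAvg_wedge, Finset.sum_apply]

/-- In d_v h_v σ, differentiating the factors u_c gives l + 1 times the average of σ by
`sum_wedge_contract`. Differentiating the averages gives a double sum that cancels the one in h_v
d_v σ. `integral_radial` adds up what remains. -/
theorem vert_homotopy_formula {σ : PreForm p q} (hσ : σ ∈ Forms p q k (l + 1)) :
    vertDeriv (vertHomotopy σ) + vertHomotopy (vertDeriv σ) = σ := by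
  obtain ⟨B, hB, hB', hB''⟩ := exists_isLocal_triple hσ (vertDeriv_mem hσ) (vertHomotopy_mem hσ)
  funext T n u
  rw [Pi.add_apply, Pi.add_apply, Pi.add_apply, vertHomotopy_vertDeriv hσ hB hB',
    vertDeriv_eq_sum hB'']
  have h1 : ∀ d ∈ B, wedge (Gen.du d) (pd d (vertHomotopy σ)) T n u =
      wedge (Gen.du d) (radialAvg l (contract (Gen.du d) σ)) T n u +
      ∑ c ∈ B, u c *
        wedge (Gen.du d) (radialAvg (l + 1) (contract (Gen.du c) (pd d σ))) T n u := by
    intro d hd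
    by_cases hdT : Gen.du d ∈ T
    · simp only [wedge, hdT, if_true, pd_vertHomotopy hσ hB hd, mul_add, Finset.mul_sum]
      congr 1
      exact Finset.sum_congr rfl fun c _ => by ring
    · simp [wedge, hdT]
  have h2 : ∑ d ∈ B, wedge (Gen.du d) (radialAvg l (contract (Gen.du d) σ)) =
      ((l + 1 : ℕ) : ℝ) • radialAvg l σ := by
    simp only [← radialAvg_wedge]
    rw [← radialAvg_sum l B fun d => wedge_du_mem (contract_du_mem hσ d) d,
      sum_wedge_contract hB hσ, radialAvg_smul]
  have h3 := congrFun (congrFun (congrFun h2 T) n) u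
  simp only [Finset.sum_apply, Pi.smul_apply, smul_eq_mul] at h3 ⊢
  rw [Finset.sum_congr rfl h1, Finset.sum_add_distrib, h3, ← integral_radial hσ hB l T n u]
  ring

theorem vert_homotopy_formula_zero {σ : PreForm p q} (hσ : σ ∈ Forms p q k 0)
    (T : Finset (Gen p q)) (n : Fin p → ℤ) (u : Prol p q) :
    vertHomotopy (vertDeriv σ) T n u = σ T n u - σ T n 0 := by
  obtain ⟨B, hB, hB', -⟩ := exists_isLocal_triple hσ (vertDeriv_mem hσ) hσ
  have h0 : ∀ c d, contract (Gen.du c) (pd d σ) = 0 := fun c d => by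
    funext T n u
    by_cases hcT : Gen.du c ∈ T
    · simp [contract, hcT]
    have : pd d σ (insert (Gen.du c) T) = 0 := by
      by_contra h
      have := ((pd_mem hσ d).1 _ h).2
      rw [vdeg_insert_du hcT] at this
      omega
    simp [contract, this]
  have hz : radialAvg 0 (0 : PreForm p q) = 0 := by funext T n u; simp [radialAvg]
  rw [vertHomotopy_vertDeriv hσ hB hB', integral_radial_zero hσ hB]
  simp [h0, hz, wedge_zero]

end vertical

/-! ### A left inverse of S_i - id on forms within a window of labels -/

section truncation

variable {p q k l : ℕ}

/-- Setting to zero all coordinates `u^α_J` with `J_i < a`, as a linear map on coefficients. -/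
def trunc (i : Fin p) (a : ℤ) : PreForm p q →ₗ[ℝ] PreForm p q where
  toFun σ := fun T n u => σ T n fun c => if a ≤ c.2 i then u c else 0
  map_add' _ _ := rfl
  map_smul' _ _ := rfl

theorem trunc_apply (i : Fin p) (a : ℤ) (σ : PreForm p q) (T : Finset (Gen p q)) (n : Fin p → ℤ)
    (u : Prol p q) : trunc i a σ T n u = σ T n fun c => if a ≤ c.2 i then u c else 0 := rfl

theorem trunc_wedge (i : Fin p) (a : ℤ) (g : Gen p q) (σ : PreForm p q) :
    trunc i a (wedge g σ) = wedge g (trunc i a σ) := rfl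

theorem trunc_contract (i : Fin p) (a : ℤ) (g : Gen p q) (σ : PreForm p q) :
    trunc i a (contract g σ) = contract g (trunc i a σ) := rfl

theorem trunc_shift (i : Fin p) (a : ℤ) (K : Fin p → ℤ) (σ : PreForm p q) :
    trunc i a (shift K σ) = shift K (trunc i (a - K i) σ) := by
  funext T n u
  simp only [trunc_apply, shift, Pi.add_apply, sub_le_iff_le_add]

theorem trunc_trunc (i : Fin p) (a b : ℤ) (σ : PreForm p q) :
    trunc i a (trunc i b σ) = trunc i (max a b) σ := by
  funext T n u
  simp only [trunc_apply, max_le_iff]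
  congr 1
  funext c
  split_ifs <;> tauto

theorem trunc_comm (i j : Fin p) (a b : ℤ) (σ : PreForm p q) :
    trunc i a (trunc j b σ) = trunc j b (trunc i a σ) := by
  funext T n u
  simp only [trunc_apply]
  congr 1
  funext c
  split_ifs <;> rfl

theorem trunc_mem {σ : PreForm p q} (hσ : σ ∈ Forms p q k l) (i : Fin p) (a : ℤ) :
    trunc i a σ ∈ Forms p q k l := by
  obtain ⟨h1, B, hB⟩ := hσ
  refine ⟨fun T hT => h1 T fun h => hT (by funext n u; simp [trunc_apply, h]), B,
    fun T h => by funext n u; simp [trunc_apply, hB.1 T h], fun T n => ?_⟩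
  obtain ⟨g, hg, hg'⟩ := hB.2 T n
  refine ⟨fun v => g fun b => if a ≤ b.1.2 i then v b else 0, hg.comp (contDiff_pi.2 fun b => ?_),
    fun u => by simp [trunc_apply, hg']⟩
  split_ifs
  · exact contDiff_apply ℝ ℝ b
  · exact contDiff_const

/-- Summation in the direction `i` of the parts of `σ` supported in `a + m + 1 ≤ J_i`, after they
have been moved by `-(m + 1)`. -/
def sumBelow (i : Fin p) (a : ℤ) (N : ℕ) : PreForm p q →ₗ[ℝ] PreForm p q :=
  ∑ m ∈ Finset.range N, shiftL (Pi.single i (-((m + 1 : ℕ) : ℤ))) ∘ₗ trunc i (a + (m + 1 : ℕ))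

theorem sumBelow_apply (i : Fin p) (a : ℤ) (N : ℕ) (σ : PreForm p q) :
    sumBelow i a N σ = ∑ m ∈ Finset.range N,
      shift (Pi.single i (-((m + 1 : ℕ) : ℤ))) (trunc i (a + (m + 1 : ℕ)) σ) := by
  simp [sumBelow, LinearMap.sum_apply]

theorem sumBelow_mem {σ : PreForm p q} (hσ : σ ∈ Forms p q k l) (i : Fin p) (a : ℤ) (N : ℕ) :
    sumBelow i a N σ ∈ Forms p q k l := by
  rw [sumBelow_apply]
  exact Submodule.sum_mem _ fun m _ => shift_mem (trunc_mem hσ i _) _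

theorem sumBelow_wedge (i : Fin p) (a : ℤ) (N : ℕ) (j : Fin p) (σ : PreForm p q) :
    sumBelow i a N (wedge (Gen.delta j) σ) = wedge (Gen.delta j) (sumBelow i a N σ) := by
  simp only [sumBelow_apply, wedge_sum, trunc_wedge, shift_wedge_delta]

theorem sumBelow_shift_of_ne {i j : Fin p} (hij : j ≠ i) (a : ℤ) (N : ℕ) (σ : PreForm p q) :
    sumBelow i a N (shift (unit j) σ) = shift (unit j) (sumBelow i a N σ) := by
  simp only [sumBelow_apply, shift_sum, trunc_shift, shift_comm (unit j)]
  simp [unit, Pi.single_eq_of_ne hij.symm]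

theorem shift_unit_single (i : Fin p) (a : ℤ) (σ : PreForm p q) :
    shift (unit i) (shift (Pi.single i a) σ) = shift (Pi.single i (1 + a)) σ := by
  rw [shift_shift, ← Pi.single_add]

/-- `σ` depends, in the direction `i`, only on coordinates with `a ≤ J_i`, and vanishes when those
with `J_i < a + N` are set to zero. -/
structure Within (i : Fin p) (a : ℤ) (N : ℕ) (σ : PreForm p q) : Prop where
  lower : trunc i a σ = σ
  upper : trunc i (a + N) σ = 0

theorem Within.sub {i : Fin p} {a : ℤ} {N : ℕ} {σ τ : PreForm p q} (hσ : Within i a N σ)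
    (hτ : Within i a N τ) : Within i a N (σ - τ) :=
  ⟨by rw [map_sub, hσ.lower, hτ.lower], by rw [map_sub, hσ.upper, hτ.upper, sub_zero]⟩

theorem Within.sum {ι : Type*} {s : Finset ι} {i : Fin p} {a : ℤ} {N : ℕ} {σ : ι → PreForm p q}
    (hσ : ∀ x ∈ s, Within i a N (σ x)) : Within i a N (∑ x ∈ s, σ x) :=
  ⟨by rw [map_sum]; exact Finset.sum_congr rfl fun x hx => (hσ x hx).lower,
    by rw [map_sum]; exact Finset.sum_eq_zero fun x hx => (hσ x hx).upper⟩

theorem Within.wedge {i : Fin p} {a : ℤ} {N : ℕ} {σ : PreForm p q} (hσ : Within i a N σ)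
    (g : Gen p q) : Within i a N (wedge g σ) :=
  ⟨by rw [trunc_wedge, hσ.lower], by rw [trunc_wedge, hσ.upper, wedge_zero]⟩

theorem Within.contract {i : Fin p} {a : ℤ} {N : ℕ} {σ : PreForm p q} (hσ : Within i a N σ)
    (g : Gen p q) : Within i a N (contract g σ) :=
  ⟨by rw [trunc_contract, hσ.lower], by rw [trunc_contract, hσ.upper, contract_zero]⟩

/-- `m ≤ r` keeps the moved labels at or above a, and `r ≤ N + m` lets the upper bound of σ take
over. The case r = m gives the summands of `sumBelow`, and r = m + 1 those of its unit shift. -/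
theorem Within.shift_trunc_self {i : Fin p} {a : ℤ} {N : ℕ} {σ : PreForm p q}
    (hσ : Within i a N σ) {m r : ℕ} (hmr : m ≤ r) (hr : r ≤ N + m) :
    Within i a N (shift (Pi.single i (-(m : ℤ))) (trunc i (a + r) σ)) := by
  refine ⟨?_, ?_⟩
  · rw [trunc_shift, trunc_trunc, Pi.single_eq_same, max_eq_right (by omega)]
  -- Both maxima equal a + N + m; the second one exposes the truncation at a + N, which kills σ.
  · rw [trunc_shift, trunc_trunc, Pi.single_eq_same,
      show max (a + (N : ℤ) - -(m : ℤ)) (a + r) = max (a + N + m) (a + N) by omega,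
      ← trunc_trunc, hσ.upper, map_zero, shift_zero]

theorem Within.shift_trunc_of_ne {i j : Fin p} (hij : i ≠ j) {a : ℤ} {N : ℕ} {σ : PreForm p q}
    (hσ : Within i a N σ) (b c : ℤ) : Within i a N (shift (Pi.single j b) (trunc j c σ)) := by
  refine ⟨?_, ?_⟩
  · rw [trunc_shift, Pi.single_eq_of_ne hij, sub_zero, trunc_comm, hσ.lower]
  · rw [trunc_shift, Pi.single_eq_of_ne hij, sub_zero, trunc_comm, hσ.upper, map_zero, shift_zero]

theorem Within.sumBelow {i j : Fin p} {a : ℤ} {N : ℕ} {σ : PreForm p q}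
    (hσ : Within i a N σ) : Within i a N (sumBelow j a N σ) := by
  rw [sumBelow_apply]
  refine Within.sum fun m hm => ?_
  have := Finset.mem_range.1 hm
  by_cases hij : i = j
  · subst hij
    exact hσ.shift_trunc_self le_rfl (by omega)
  · exact hσ.shift_trunc_of_ne hij _ _

theorem Within.shift_sumBelow {i j : Fin p} {a : ℤ} {N : ℕ} {σ : PreForm p q}
    (hσ : Within i a N σ) : Within i a N (shift (unit j) (DVB.sumBelow j a N σ)) := by
  rw [sumBelow_apply, shift_sum]
  refine Within.sum fun m hm => ?_
  have := Finset.mem_range.1 hm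
  rw [shift_unit_single, show (1 : ℤ) + -((m + 1 : ℕ) : ℤ) = -(m : ℤ) by push_cast; ring]
  by_cases hij : i = j
  · subst hij
    exact hσ.shift_trunc_self (by omega) (by omega)
  · exact hσ.shift_trunc_of_ne hij _ _

/-- Passing S_i through a truncation lowers its cutoff by one, so the sum telescopes to the
truncation of σ at a minus a shift of its truncation at a + N, that is, to σ - 0. -/
theorem Within.sumBelow_shift_sub {i : Fin p} {a : ℤ} {N : ℕ} {σ : PreForm p q}
    (hσ : Within i a N σ) : DVB.sumBelow i a N (shift (unit i) σ - σ) = σ := by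
  have h1 : DVB.sumBelow i a N (shift (unit i) σ) = ∑ m ∈ Finset.range N,
      shift (Pi.single i (-(m : ℤ))) (trunc i (a + m) σ) := by
    rw [sumBelow_apply]
    refine Finset.sum_congr rfl fun m _ => ?_
    rw [trunc_shift, shift_shift, unit, ← Pi.single_add, Pi.single_eq_same]
    congr 3
    · push_cast; ring
    · push_cast; ring
  have h2 := Finset.sum_range_sub
    (fun m : ℕ => shift (Pi.single i (-(m : ℤ))) (trunc i (a + m) σ)) N
  rw [map_sub, h1, sumBelow_apply, ← neg_sub, ← Finset.sum_sub_distrib, h2]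
  simp [hσ.upper, hσ.lower, shift_zero, shift_zero_left]

end truncation

/-! ### A right inverse of S_i - id on forms independent of u -/

section summation

variable {p q k l : ℕ}

/-- The difference of the two sums is the oriented sum from 0 to n; at least one interval is always
empty. -/
theorem sum_Ico_int_succ {M : Type*} [AddCommGroup M] (f : ℤ → M) (n : ℤ) :
    (∑ m ∈ Finset.Ico 0 (n + 1), f m - ∑ m ∈ Finset.Ico (n + 1) 0, f m) =
      (∑ m ∈ Finset.Ico 0 n, f m - ∑ m ∈ Finset.Ico n 0, f m) + f n := by
  rcases le_or_gt 0 n with hn | hn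
  · have h1 : Finset.Ico 0 (n + 1) = insert n (Finset.Ico 0 n) := by ext; simp; omega
    rw [h1, Finset.sum_insert (by simp), Finset.Ico_eq_empty (a := n + 1) (by omega),
      Finset.Ico_eq_empty (a := n) (by omega)]
    simp [add_comm]
  · have h1 : Finset.Ico n 0 = insert n (Finset.Ico (n + 1) 0) := by ext; simp; omega
    rw [h1, Finset.sum_insert (by simp), Finset.Ico_eq_empty (b := n + 1) (by omega),
      Finset.Ico_eq_empty (b := n) (by omega)]
    simp

/-- Summation in the direction `i` along the lattice `ℤ^p`. -/
def latticeSum (i : Fin p) : PreForm p q →ₗ[ℝ] PreForm p q where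
  toFun σ := fun T n u => ∑ m ∈ Finset.Ico 0 (n i), shift (Pi.single i (m - n i)) σ T n u -
    ∑ m ∈ Finset.Ico (n i) 0, shift (Pi.single i (m - n i)) σ T n u
  map_add' σ τ := by
    funext T n u
    simp only [shift_add, Pi.add_apply, Finset.sum_add_distrib]
    ring
  map_smul' a σ := by
    funext T n u
    simp [shift_smul, Finset.mul_sum, mul_sub]

theorem latticeSum_apply (i : Fin p) (σ : PreForm p q) (T : Finset (Gen p q)) (n : Fin p → ℤ)
    (u : Prol p q) : latticeSum i σ T n u =
      ∑ m ∈ Finset.Ico 0 (n i), shift (Pi.single i (m - n i)) σ T n u -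
      ∑ m ∈ Finset.Ico (n i) 0, shift (Pi.single i (m - n i)) σ T n u := rfl

theorem latticeSum_wedge (i j : Fin p) (σ : PreForm p q) :
    latticeSum i (wedge (Gen.delta j) σ) = wedge (Gen.delta j) (latticeSum i σ) := by
  funext T n u
  by_cases hj : Gen.delta j ∈ T
  · simp only [latticeSum_apply, shift_wedge_delta, wedge, hj, if_true, mul_sub, Finset.mul_sum]
  · simp [latticeSum_apply, shift_wedge_delta, wedge, hj]

theorem latticeSum_contract (i j : Fin p) (σ : PreForm p q) :
    latticeSum i (contract (Gen.delta j) σ) = contract (Gen.delta j) (latticeSum i σ) := by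
  funext T n u
  by_cases hj : Gen.delta j ∈ T
  · simp [latticeSum_apply, shift_contract_delta, contract, hj]
  · simp only [latticeSum_apply, shift_contract_delta, contract, hj, if_false, mul_sub,
      Finset.mul_sum]

theorem shift_latticeSum (i : Fin p) (K : Fin p → ℤ) (σ : PreForm p q) (T : Finset (Gen p q))
    (n : Fin p → ℤ) (u : Prol p q) : shift K (latticeSum i σ) T n u =
      ∑ m ∈ Finset.Ico 0 (n i + K i), shift (Pi.single i (m - (n i + K i))) (shift K σ) T n u -
      ∑ m ∈ Finset.Ico (n i + K i) 0, shift (Pi.single i (m - (n i + K i))) (shift K σ) T n u := by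
  simp only [shift_comm _ K]
  rfl

theorem latticeSum_shift_of_ne {i j : Fin p} (hij : j ≠ i) (σ : PreForm p q) :
    latticeSum i (shift (unit j) σ) = shift (unit j) (latticeSum i σ) := by
  funext T n u
  rw [shift_latticeSum]
  simp [latticeSum_apply, unit, Pi.single_eq_of_ne hij.symm]

/-- The term m of the sum lives at lattice coordinate n_i = m. Advancing n_i by one adds the term m
= n_i, whose shift is zero. -/
theorem shift_latticeSum_sub (i : Fin p) (σ : PreForm p q) :
    shift (unit i) (latticeSum i σ) - latticeSum i σ = σ := by
  funext T n u
  have h : ∀ m, shift (Pi.single i (m - (n i + 1))) (shift (unit i) σ) =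
      shift (Pi.single i (m - n i)) σ := fun m => by
    rw [shift_shift, unit, ← Pi.single_add]
    congr 2
    ring
  simp only [Pi.sub_apply, shift_latticeSum, latticeSum_apply, unit, Pi.single_eq_same, h,
    sum_Ico_int_succ]
  simp [shift_zero_left]

/-- The coefficients do not depend on `u`. -/
def IsConst (σ : PreForm p q) : Prop := ∀ T n u, σ T n u = σ T n 0

theorem IsConst.sub {σ τ : PreForm p q} (hσ : IsConst σ) (hτ : IsConst τ) : IsConst (σ - τ) :=
  fun T n u => by simp [hσ T n u, hτ T n u]

theorem IsConst.shift {σ : PreForm p q} (hσ : IsConst σ) (K : Fin p → ℤ) :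
    IsConst (shift K σ) := fun T n u => by
  simp only [DVB.shift]
  rw [hσ, hσ _ _ fun c => (0 : Prol p q) (c.1, c.2 + K)]

theorem IsConst.wedge {σ : PreForm p q} (hσ : IsConst σ) (g : Gen p q) :
    IsConst (wedge g σ) := fun T n u => by simp only [DVB.wedge]; rw [hσ]

theorem IsConst.contract {σ : PreForm p q} (hσ : IsConst σ) (g : Gen p q) :
    IsConst (contract g σ) := fun T n u => by simp only [DVB.contract]; rw [hσ]

theorem IsConst.latticeSum {σ : PreForm p q} (hσ : IsConst σ) (i : Fin p) :
    IsConst (latticeSum i σ) := fun T n u => by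
  simp only [latticeSum_apply, fun m => hσ.shift (Pi.single i (m - n i)) T n u]

/-- Independence of u matters here: the shifts m - n_i are unbounded in n, so in general no finite
set of coordinates would serve all n. -/
theorem latticeSum_mem {σ : PreForm p q} (hσ : σ ∈ Forms p q k 0) (hc : IsConst σ) (i : Fin p) :
    latticeSum i σ ∈ Forms p q k 0 := by
  have h1 : ∀ T, latticeSum i σ T ≠ 0 → hdeg T = k ∧ vdeg T = 0 := fun T hT => by
    by_contra h
    refine hT ?_
    funext n u
    have h0 : ∀ K, shift K σ T = 0 := fun K => by
      by_contra h'
      exact h ((shift_mem hσ K).1 T h')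
    simp [latticeSum_apply, h0]
  refine ⟨h1, ∅, fun T ⟨c, _, hcT⟩ => ?_, fun T n => ?_⟩
  · by_contra h
    have := (h1 T h).2
    rw [vdeg, Finset.card_eq_zero] at this
    exact Finset.notMem_empty (Gen.du c) (this ▸ Finset.mem_filter.2 ⟨hcT, rfl⟩)
  · exact ⟨fun _ => latticeSum i σ T n 0, contDiff_const, fun u => hc.latticeSum i T n u⟩

end summation

/-! ### Exactness of the horizontal complex in vertical degree zero -/

section exactness

variable {p q k : ℕ}

/-- If every closed form of a class can be changed by an exact form so that it is killed by one of
the operators `kill i`, then it can be changed so that all of them kill it. -/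
theorem exists_killed {Good : PreForm p q → Prop} {kill : Fin p → PreForm p q → PreForm p q}
    (h : ∀ i σ, Good σ → ∃ τ ∈ Forms p q k 0, Good (σ - extDiff τ) ∧
      kill i (σ - extDiff τ) = 0 ∧ ∀ j, kill j σ = 0 → kill j (σ - extDiff τ) = 0)
    {σ : PreForm p q} (hσ : Good σ) :
    ∃ τ ∈ Forms p q k 0, Good (σ - extDiff τ) ∧ ∀ j, kill j (σ - extDiff τ) = 0 := by
  classical
  suffices H : ∀ s : Finset (Fin p), ∃ τ ∈ Forms p q k 0, Good (σ - extDiff τ) ∧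
      ∀ j ∈ s, kill j (σ - extDiff τ) = 0 by
    obtain ⟨τ, h1, h2, h3⟩ := H Finset.univ
    exact ⟨τ, h1, h2, fun j => h3 j (Finset.mem_univ j)⟩
  intro s
  induction s using Finset.induction_on with
  | empty => exact ⟨0, zero_mem _, by simpa [← extDiffL_apply] using hσ, by simp⟩
  | insert i s _ ih =>
    obtain ⟨τ, h1, h2, h3⟩ := ih
    obtain ⟨ρ, g1, g2, g3, g4⟩ := h i _ h2
    have e : σ - extDiff (τ + ρ) = σ - extDiff τ - extDiff ρ := by rw [extDiff_add, sub_sub]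
    refine ⟨τ + ρ, add_mem h1 g1, e ▸ g2, fun j hj => ?_⟩
    rw [e]
    rcases Finset.mem_insert.1 hj with rfl | hj
    · exact g3
    · exact g4 j (h3 j hj)

theorem delta_mem_of_wedge_eq_zero {σ : PreForm p q} {i : Fin p}
    (h : wedge (Gen.delta i) σ = 0) {T : Finset (Gen p q)} (hT : σ T ≠ 0) : Gen.delta i ∈ T := by
  by_contra hi
  refine hT ?_
  funext n u
  have := congrFun (congrFun (congrFun (contract_wedge_self (Gen.delta i) σ) T) n) u
  rw [h, contract_zero] at this
  simpa [wedge, hi] using this.symm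

theorem delta_notMem_of_contract_eq_zero {σ : PreForm p q} {i : Fin p}
    (h : contract (Gen.delta i) σ = 0) {T : Finset (Gen p q)} (hT : σ T ≠ 0) :
    Gen.delta i ∉ T := by
  intro hi
  refine hT ?_
  funext n u
  have := wedge_contract_self (Gen.delta i) σ T n u
  rw [h, wedge_zero, if_pos hi] at this
  exact this.symm

theorem closed_const_exact {σ : PreForm p q} (hσ : σ ∈ Forms p q (k + 1) 0) (hc : IsConst σ)
    (hd : extDiff σ = 0) : ∃ τ ∈ Forms p q k 0, σ = extDiff τ := by
  obtain ⟨τ, hτ, ⟨h1, h2, h3⟩, h4⟩ := exists_killed (k := k)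
    (Good := fun σ : PreForm p q => σ ∈ Forms p q (k + 1) 0 ∧ IsConst σ ∧ extDiff σ = 0)
    (kill := fun i => contract (Gen.delta i))
    (by
      rintro i σ ⟨h1, h2, h3⟩
      have hmem : contract (Gen.delta i) (latticeSum i σ) ∈ Forms p q k 0 :=
        contract_delta_mem (latticeSum_mem h1 h2 i) i
      -- As `latticeSum i` is a right inverse of S_i - id, subtracting the exact form cancels Δ^i ∧
      -- ι_i σ, and only monomials without Δ^i are left.
      have key : σ - extDiff (contract (Gen.delta i) (latticeSum i σ)) =
          contract (Gen.delta i) (wedge (Gen.delta i)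
            (σ - latticeSum i (shift (unit i) σ - σ))) := by
        have := extDiff_contract_add (latticeSum i) i (latticeSum_wedge i)
          (fun j hj => latticeSum_shift_of_ne hj) σ
        rw [h3, map_zero, contract_zero, add_zero, shift_latticeSum_sub] at this
        rw [this, wedge_sub, contract_sub]
        nth_rewrite 1 [← contract_wedge_self (Gen.delta i) σ]
        abel
      refine ⟨_, hmem, ⟨sub_mem h1 (extDiff_mem hmem), ?_, ?_⟩, ?_, fun j hj => ?_⟩
      · rw [key]
        exact ((h2.sub ((h2.shift _).sub h2 |>.latticeSum i)).wedge _).contract _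
      · rw [extDiff_sub, extDiff_extDiff, h3, sub_zero]
      · rw [key, contract_self]
      · rw [key]
        by_cases hij : j = i
        · subst hij; rw [contract_self]
        -- Summation and shifts commute with ι_j, so a Δ^j removed earlier does not reappear.
        · have h0 : contract (Gen.delta j) (σ - latticeSum i (shift (unit i) σ - σ)) = 0 := by
            rw [contract_sub, hj, ← latticeSum_contract, contract_sub, hj, ← shift_contract_delta, hj,
              shift_zero, sub_zero, map_zero, sub_zero]
          rw [contract_anticomm, contract_wedge_of_ne (by simpa using hij), h0, wedge_zero, neg_zero,
            contract_zero, neg_zero])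
    ⟨hσ, hc, hd⟩
  refine ⟨τ, hτ, sub_eq_zero.1 ?_⟩
  funext T
  by_contra hT
  have := (h1.1 T hT).1
  rw [hdeg, Finset.filter_false_of_mem] at this
  · simp at this
  · rintro (i | c) hg
    · exact absurd hg (delta_notMem_of_contract_eq_zero (h4 i) hT)
    · simp [Gen.isDelta]

theorem closed_within_exact {a : ℤ} {N : ℕ} {σ : PreForm p q} (hk : k + 1 < p)
    (hσ : σ ∈ Forms p q (k + 1) 0) (hw : ∀ i, Within i a N σ) (hd : extDiff σ = 0) :
    ∃ τ ∈ Forms p q k 0, σ = extDiff τ := by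
  obtain ⟨τ, hτ, ⟨h1, h2, h3⟩, h4⟩ := exists_killed (k := k)
    (Good := fun σ : PreForm p q =>
      σ ∈ Forms p q (k + 1) 0 ∧ (∀ i, Within i a N σ) ∧ extDiff σ = 0)
    (kill := fun i => wedge (Gen.delta i))
    (by
      rintro i σ ⟨h1, h2, h3⟩
      have hmem : contract (Gen.delta i) (sumBelow i a N σ) ∈ Forms p q k 0 :=
        contract_delta_mem (sumBelow_mem h1 i a N) i
      -- Here `sumBelow` is a left inverse of S_i - id, so the subtraction cancels ι_i (Δ^i ∧ σ)
      -- instead, and every remaining monomial contains Δ^i.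
      have key : σ - extDiff (contract (Gen.delta i) (sumBelow i a N σ)) =
          wedge (Gen.delta i) (contract (Gen.delta i)
            (σ - (shift (unit i) (sumBelow i a N σ) - sumBelow i a N σ))) := by
        have := extDiff_contract_add (sumBelow i a N) i (sumBelow_wedge i a N)
          (fun j hj => sumBelow_shift_of_ne hj a N) σ
        rw [h3, map_zero, contract_zero, add_zero, (h2 i).sumBelow_shift_sub] at this
        rw [this, contract_sub _ σ, wedge_sub _ (contract _ σ)]
        nth_rewrite 1 [← contract_wedge_self (Gen.delta i) σ]
        abel
      refine ⟨_, hmem, ⟨sub_mem h1 (extDiff_mem hmem), fun j => ?_, ?_⟩, ?_, fun j hj => ?_⟩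
      · rw [key]
        exact (((h2 j).sub ((h2 j).shift_sumBelow.sub (h2 j).sumBelow)).contract _).wedge _
      · rw [extDiff_sub, extDiff_extDiff, h3, sub_zero]
      · rw [key, wedge_self]
      · rw [key]
        by_cases hij : j = i
        · subst hij; rw [wedge_self]
        · have h0 : wedge (Gen.delta j)
              (σ - (shift (unit i) (sumBelow i a N σ) - sumBelow i a N σ)) = 0 := by
            rw [wedge_sub, wedge_sub, hj, ← shift_wedge_delta, ← sumBelow_wedge, hj, map_zero,
              shift_zero, sub_zero, sub_zero]
          have h8 := contract_wedge_of_ne (g := Gen.delta i) (h := Gen.delta j)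
            (by simpa using Ne.symm hij) (σ - (shift (unit i) (sumBelow i a N σ) - sumBelow i a N σ))
          rw [h0, contract_zero] at h8
          rw [wedge_anticomm, neg_eq_zero.1 h8.symm, wedge_zero, neg_zero])
    ⟨hσ, hw, hd⟩
  refine ⟨τ, hτ, sub_eq_zero.1 ?_⟩
  funext T
  by_contra hT
  have h5 := (h1.1 T hT).1
  classical
  -- A surviving monomial contains all p symbols Δ^i, against its degree k + 1 < p.
  have h6 : Finset.univ.image Gen.delta ⊆ T.filter fun g => g.isDelta = true := fun g hg => by
    obtain ⟨i, -, rfl⟩ := Finset.mem_image.1 hg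
    exact Finset.mem_filter.2 ⟨delta_mem_of_wedge_eq_zero (h4 i) hT, rfl⟩
  have h7 := Finset.card_le_card h6
  rw [Finset.card_image_of_injective _ (fun i j h => by simpa using h), Finset.card_univ,
    Fintype.card_fin, ← hdeg, h5] at h7
  omega

/-- The part of `σ` with coefficients `σ(n, 0)`. -/
def atZero : PreForm p q →ₗ[ℝ] PreForm p q where
  toFun σ := fun T n _ => σ T n 0
  map_add' _ _ := rfl
  map_smul' _ _ := rfl

theorem atZero_apply (σ : PreForm p q) (T : Finset (Gen p q)) (n : Fin p → ℤ) (u : Prol p q) :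
    atZero σ T n u = σ T n 0 := rfl

theorem atZero_isConst (σ : PreForm p q) : IsConst (atZero σ) := fun _ _ _ => rfl

theorem atZero_mem {l : ℕ} {σ : PreForm p q} (hσ : σ ∈ Forms p q k l) :
    atZero σ ∈ Forms p q k l := by
  obtain ⟨h1, B, hB⟩ := hσ
  exact ⟨fun T hT => h1 T fun h => hT (by funext n u; simp [atZero_apply, h]), B,
    fun T h => by funext n u; simp [atZero_apply, hB.1 T h],
    fun T n => ⟨fun _ => σ T n 0, contDiff_const, fun _ => rfl⟩⟩

theorem atZero_extDiff (σ : PreForm p q) : atZero (extDiff σ) = extDiff (atZero σ) := by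
  have hs : ∀ K, atZero (shift K σ) = shift K (atZero σ) := fun K => rfl
  have hw : ∀ g (τ : PreForm p q), atZero (wedge g τ) = wedge g (atZero τ) := fun _ _ => rfl
  simp only [extDiff_apply, map_sum, hw, map_sub, hs]

/-- Only finitely many labels occur in the coefficients, so all lie strictly between -M and M in
every direction. Truncating at M then leaves σ(n,0), which the subtraction cancels. -/
theorem exists_within {l : ℕ} {σ : PreForm p q} (hσ : σ ∈ Forms p q k l) :
    ∃ a N, ∀ i, Within i a N (σ - atZero σ) := by
  obtain ⟨B, hB⟩ := hσ.2
  obtain ⟨M, hM⟩ : ∃ M : ℕ, ∀ c ∈ B, ∀ i, |c.2 i| < M := by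
    refine ⟨∑ c ∈ B, ∑ i, (c.2 i).natAbs + 1, fun c hc i => ?_⟩
    have h1 := Finset.single_le_sum (f := fun c : Coord p q => ∑ i, (c.2 i).natAbs)
      (fun _ _ => Nat.zero_le _) hc
    have h2 := Finset.single_le_sum (f := fun i => (c.2 i).natAbs)
      (fun _ _ => Nat.zero_le _) (Finset.mem_univ i)
    have h3 := Int.abs_eq_natAbs (c.2 i)
    omega
  refine ⟨-M, 2 * M, fun i => ⟨?_, ?_⟩⟩
  · funext T n u
    obtain ⟨g, -, hg⟩ := hB.2 T n
    simp only [trunc_apply, Pi.sub_apply, atZero_apply, hg]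
    congr 2
    funext b
    exact if_pos (abs_lt.1 (hM b b.2 i)).1.le
  · funext T n u
    obtain ⟨g, -, hg⟩ := hB.2 T n
    simp only [trunc_apply, Pi.sub_apply, atZero_apply, hg, Pi.zero_apply, sub_eq_zero]
    congr 1
    funext b
    have := (abs_lt.1 (hM b b.2 i)).2
    exact if_neg (by push_cast; omega)

theorem closed_exact (hk : k + 1 < p) {σ : PreForm p q} (hσ : σ ∈ Forms p q (k + 1) 0)
    (hd : extDiff σ = 0) : ∃ τ ∈ Forms p q k 0, σ = extDiff τ := by
  have h0 : extDiff (atZero σ) = 0 := by rw [← atZero_extDiff, hd, map_zero]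
  obtain ⟨τ, hτ, h1⟩ := closed_const_exact (atZero_mem hσ) (atZero_isConst σ) h0
  obtain ⟨a, N, hw⟩ := exists_within hσ
  obtain ⟨ρ, hρ, h2⟩ := closed_within_exact hk (sub_mem hσ (atZero_mem hσ)) hw
    (by rw [extDiff_sub, hd, h0, sub_zero])
  exact ⟨τ + ρ, add_mem hτ hρ, by rw [extDiff_add, ← h1, ← h2]; abel⟩

/-- In degree zero ι_i σ = 0, so Cartan's formula reduces to S_i σ = σ. -/
theorem closed_zero_shift {σ : PreForm p q} (hσ : σ ∈ Forms p q 0 0) (hd : extDiff σ = 0)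
    (K : Fin p → ℤ) : shift K σ = σ := by
  let G : AddSubgroup (Fin p → ℤ) :=
    { carrier := {K | shift K σ = σ}
      zero_mem' := shift_zero_left σ
      add_mem' := fun {K L} hK hL => by
        change shift (K + L) σ = σ
        rw [← shift_shift, hL, hK]
      neg_mem' := fun {K} hK => by
        change shift (-K) σ = σ
        conv_lhs => rw [← show shift K σ = σ from hK]
        rw [shift_shift, neg_add_cancel, shift_zero_left] }
  refine addSubgroup_eq_top G (fun i => ?_) K
  have h : contract (Gen.delta i) σ = 0 := by
    funext T n u
    by_cases hi : Gen.delta i ∈ T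
    · simp [contract, hi]
    have : σ (insert (Gen.delta i) T) = 0 := by
      by_contra h
      have := (hσ.1 _ h).1
      rw [hdeg_insert_delta hi] at this
      omega
    simp [contract, this]
  have h1 := extDiff_contract i σ
  rw [hd, h, contract_zero, ← extDiffL_apply, map_zero, add_zero] at h1
  exact sub_eq_zero.1 h1.symm

/-- σ - σ(n,0) is shift invariant and lies in a finite window, where S_i - id is injective, so it
vanishes. This uses one direction, hence p ≥ 1. The shift by n then carries the value at n to the
origin. -/
theorem closed_zero_const {m : ℕ} {σ : PreForm (m + 1) q} (hσ : σ ∈ Forms (m + 1) q 0 0)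
    (hd : extDiff σ = 0) (n : Fin (m + 1) → ℤ) (u : Prol (m + 1) q) : σ ∅ n u = σ ∅ 0 0 := by
  have h1 : σ = atZero σ := by
    obtain ⟨a, N, hw⟩ := exists_within hσ
    have := (hw 0).sumBelow_shift_sub
    rw [closed_zero_shift (sub_mem hσ (atZero_mem hσ))
      (by rw [extDiff_sub, ← atZero_extDiff, hd, map_zero, sub_zero]), sub_self, map_zero] at this
    exact sub_eq_zero.1 this.symm
  have h2 := congrFun (congrFun (congrFun (closed_zero_shift hσ hd n) ∅) 0) u
  rw [h1, atZero_apply, atZero_apply]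
  rw [h1] at h2
  simpa [shift, atZero_apply] using h2

end exactness

/-! ### Descent to F^l and exactness of the full complex -/

section complex

variable {m q l : ℕ}

theorem const_injective (p q : ℕ) : Function.Injective (const p q) := fun a b h => by
  have := congrFun (congrFun (congrFun (congrArg Subtype.val h) ∅) 0) 0
  simpa [const] using this

theorem exact_const : Function.Exact (const (m + 1) q) (dH (m + 1) q 0 0) := by
  intro σ
  constructor
  · intro h
    refine ⟨(σ : PreForm (m + 1) q) ∅ 0 0, Subtype.ext ?_⟩
    funext T n u
    by_cases hT : T = ∅
    · subst hT
      simpa [const] using (closed_zero_const σ.2 (congrArg Subtype.val h) n u).symm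
    · have h0 : (σ : PreForm (m + 1) q) T = 0 := by
        by_contra h0
        obtain ⟨h1, h2⟩ := σ.2.1 T h0
        rw [hdeg, Finset.card_eq_zero] at h1
        rw [vdeg, Finset.card_eq_zero] at h2
        refine hT (Finset.eq_empty_of_forall_notMem fun g hg => ?_)
        rcases hb : g.isDelta
        · exact Finset.notMem_empty g (h2 ▸ Finset.mem_filter.2 ⟨hg, hb⟩)
        · exact Finset.notMem_empty g (h1 ▸ Finset.mem_filter.2 ⟨hg, hb⟩)
      simp [const, hT, h0]
  · rintro ⟨a, rfl⟩
    refine Subtype.ext ?_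
    change extDiff (const (m + 1) q a : PreForm (m + 1) q) = 0
    have hs : ∀ K, shift K (const (m + 1) q a : PreForm (m + 1) q) = const (m + 1) q a :=
      fun K => by
        funext T n u
        simp [shift, const]
    simp [extDiff_apply, hs, wedge_zero]

theorem exact_dH {k : ℕ} (hk : k + 1 < m + 1) :
    Function.Exact (dH (m + 1) q k 0) (dH (m + 1) q (k + 1) 0) := by
  intro σ
  constructor
  · intro h
    obtain ⟨τ, hτ, e⟩ := closed_exact hk σ.2 (congrArg Subtype.val h)
    exact ⟨⟨τ, hτ⟩, Subtype.ext e.symm⟩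
  · rintro ⟨τ, rfl⟩
    exact dH_dH τ

theorem dV_dV {p k : ℕ} (σ : Forms p q k l) : dV p q k (l + 1) (dV p q k l σ) = 0 :=
  Subtype.ext (vertDeriv_vertDeriv σ.2)

theorem dV_hV_add {p k : ℕ} (σ : Forms p q k (l + 1)) :
    dV p q k l (hV p q k l σ) + hV p q k (l + 1) (dV p q k (l + 1) σ) = σ :=
  Subtype.ext (vert_homotopy_formula σ.2)

theorem euler_euler (σ : Forms (m + 1) q (m + 1) (l + 1)) :
    euler (m + 1) q (l + 1) (euler (m + 1) q (l + 1) σ) = euler (m + 1) q (l + 1) σ := by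
  obtain ⟨τ, h⟩ := exists_sub_euler_eq_dH σ
  have := congrArg (euler (m + 1) q (l + 1)) h
  rw [euler_dH, map_sub, sub_eq_zero] at this
  exact this.symm

theorem euler_coe (σ : F (m + 1) q (l + 1)) : euler (m + 1) q (l + 1) σ = σ := by
  obtain ⟨_, τ, rfl⟩ := σ
  exact euler_euler τ

/-- I^Δ σ = σ - d_h τ, and d_v d_h τ = -d_h d_v τ is killed by the outer I^Δ. -/
theorem euler_dV_euler (σ : Forms (m + 1) q (m + 1) (l + 1)) :
    euler (m + 1) q (l + 2) (dV (m + 1) q (m + 1) (l + 1) (euler (m + 1) q (l + 1) σ)) =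
      euler (m + 1) q (l + 2) (dV (m + 1) q (m + 1) (l + 1) σ) := by
  obtain ⟨τ, h⟩ := exists_sub_euler_eq_dH σ
  rw [← sub_sub_cancel σ (euler (m + 1) q (l + 1) σ), h, map_sub, dV_dH, map_sub, map_neg,
    euler_dH, neg_zero, sub_zero]

theorem euler_hV_euler (σ : Forms (m + 1) q (m + 1) (l + 1)) :
    euler (m + 1) q l (hV (m + 1) q (m + 1) l (euler (m + 1) q (l + 1) σ)) =
      euler (m + 1) q l (hV (m + 1) q (m + 1) l σ) := by
  obtain ⟨τ, h⟩ := exists_sub_euler_eq_dH σ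
  rw [← sub_sub_cancel σ (euler (m + 1) q (l + 1) σ), h, map_sub, hV_dH, map_sub, map_neg,
    euler_dH, neg_zero, sub_zero]

theorem coe_eulerLagrange (σ : Forms (m + 1) q (m + 1) 0) :
    (eulerLagrange (m + 1) q σ : Forms (m + 1) q (m + 1) 1) =
      euler (m + 1) q 1 (dV (m + 1) q (m + 1) 0 σ) := rfl

theorem coe_deltaV (σ : F (m + 1) q l) :
    (deltaV (m + 1) q l σ : Forms (m + 1) q (m + 1) (l + 1)) =
      euler (m + 1) q (l + 1) (dV (m + 1) q (m + 1) l σ) := rfl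

theorem coe_homotopyF (σ : F (m + 1) q (l + 1)) :
    (homotopyF (m + 1) q l σ : Forms (m + 1) q (m + 1) l) =
      euler (m + 1) q l (hV (m + 1) q (m + 1) l σ) := rfl

theorem homotopy_one (σ : F (m + 1) q 1) :
    σ = eulerLagrange (m + 1) q (hV (m + 1) q (m + 1) 0 σ) +
      homotopyF (m + 1) q 1 (deltaV (m + 1) q 1 σ) := by
  refine Subtype.ext ?_
  rw [Submodule.coe_add, coe_eulerLagrange, coe_homotopyF, coe_deltaV, euler_hV_euler, ← map_add,
    dV_hV_add, euler_coe]

/-- The inner projectors drop out, leaving I^Δ (d_v h_v + h_v d_v) σ = I^Δ σ, and I^Δ fixes F. -/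
theorem homotopy_succ (σ : F (m + 1) q (l + 2)) :
    σ = deltaV (m + 1) q (l + 1) (homotopyF (m + 1) q (l + 1) σ) +
      homotopyF (m + 1) q (l + 2) (deltaV (m + 1) q (l + 2) σ) := by
  refine Subtype.ext ?_
  rw [Submodule.coe_add, coe_deltaV, coe_homotopyF, coe_homotopyF, coe_deltaV, euler_hV_euler,
    euler_dV_euler, ← map_add, dV_hV_add, euler_coe]

theorem deltaV_eulerLagrange (σ : Forms (m + 1) q (m + 1) 0) :
    deltaV (m + 1) q 1 (eulerLagrange (m + 1) q σ) = 0 := by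
  refine Subtype.ext ?_
  rw [coe_deltaV, coe_eulerLagrange, euler_dV_euler, dV_dV, map_zero]
  rfl

theorem deltaV_deltaV (σ : F (m + 1) q l) :
    deltaV (m + 1) q (l + 1) (deltaV (m + 1) q l σ) = 0 := by
  refine Subtype.ext ?_
  rw [coe_deltaV, coe_deltaV, euler_dV_euler, dV_dV, map_zero]
  rfl

theorem exact_eulerLagrange_deltaV :
    Function.Exact (eulerLagrange (m + 1) q) (deltaV (m + 1) q 1) := by
  intro σ
  constructor
  · intro h
    have := homotopy_one σ
    rw [h, map_zero, add_zero] at this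
    exact ⟨_, this.symm⟩
  · rintro ⟨τ, rfl⟩
    exact deltaV_eulerLagrange τ

theorem exact_deltaV : Function.Exact (deltaV (m + 1) q (l + 1)) (deltaV (m + 1) q (l + 2)) := by
  intro σ
  constructor
  · intro h
    have := homotopy_succ σ
    rw [h, map_zero, add_zero] at this
    exact ⟨_, this.symm⟩
  · rintro ⟨τ, rfl⟩
    exact deltaV_deltaV τ

theorem exact_dH_eulerLagrange :
    Function.Exact (dH (m + 1) q m 0) (eulerLagrange (m + 1) q) := by
  intro σ
  constructor
  · intro h
    have h1 : euler (m + 1) q 1 (dV (m + 1) q (m + 1) 0 σ) = 0 := congrArg Subtype.val h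
    obtain ⟨τ, hτ⟩ := exists_sub_euler_eq_dH (dV (m + 1) q (m + 1) 0 σ)
    rw [h1, sub_zero] at hτ
    obtain ⟨ρ, hρ, h2⟩ := closed_const_exact (atZero_mem σ.2) (atZero_isConst _)
      (eq_zero_of_mem_forms (extDiff_mem (atZero_mem σ.2)) (by omega))
    -- With d_v σ = d_h τ, anticommutation gives d_h(-h_v τ) = h_v d_v σ = σ - σ(n,0); ρ is a
    -- primitive of σ(n,0).
    refine ⟨-hV (m + 1) q m 0 τ + ⟨ρ, hρ⟩, ?_⟩
    rw [map_add, map_neg, ← hV_dH, ← hτ]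
    refine Subtype.ext ?_
    change vertHomotopy (vertDeriv (σ : PreForm (m + 1) q)) + extDiff ρ = σ
    rw [← h2]
    funext T n u
    rw [Pi.add_apply, Pi.add_apply, Pi.add_apply, vert_homotopy_formula_zero σ.2, atZero_apply,
      sub_add_cancel]
  · rintro ⟨τ, rfl⟩
    refine Subtype.ext ?_
    rw [coe_eulerLagrange, dV_dH, map_neg, euler_dH, neg_zero]
    rfl

end complex

end DVB

end

/-- The difference variational complex over `ℤ^p`, `p = m + 1 ≥ 1`, with `q` dependent variables,
`0 → ℝ → Ω^{0,0} → ⋯ → Ω^{p,0} → F^1 → F^2 → ⋯`, is exact at every place, and the operators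
`H^l = I^Δ ∘ h_v` are homotopy operators on its part `F^1 → F^2 → ⋯`. -/
theorem mainTheorem3 (m q : ℕ) :
    Function.Injective (DVB.const (m + 1) q) ∧
    Function.Exact (DVB.const (m + 1) q) (DVB.dH (m + 1) q 0 0) ∧
    (∀ k : ℕ, k + 1 < m + 1 →
      Function.Exact (DVB.dH (m + 1) q k 0) (DVB.dH (m + 1) q (k + 1) 0)) ∧
    Function.Exact (DVB.dH (m + 1) q m 0) (DVB.eulerLagrange (m + 1) q) ∧
    Function.Exact (DVB.eulerLagrange (m + 1) q) (DVB.deltaV (m + 1) q 1) ∧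
    (∀ l : ℕ, 1 ≤ l →
      Function.Exact (DVB.deltaV (m + 1) q l) (DVB.deltaV (m + 1) q (l + 1))) ∧
    (∀ σ : DVB.F (m + 1) q 1,
      σ = DVB.eulerLagrange (m + 1) q (DVB.hV (m + 1) q (m + 1) 0 σ) +
        DVB.homotopyF (m + 1) q 1 (DVB.deltaV (m + 1) q 1 σ)) ∧
    (∀ l : ℕ, 1 ≤ l → ∀ σ : DVB.F (m + 1) q (l + 1),
      σ = DVB.deltaV (m + 1) q l (DVB.homotopyF (m + 1) q l σ) +
        DVB.homotopyF (m + 1) q (l + 1) (DVB.deltaV (m + 1) q (l + 1) σ)) :=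
  ⟨DVB.const_injective _ _, DVB.exact_const, fun _ hk => DVB.exact_dH hk,
    DVB.exact_dH_eulerLagrange, DVB.exact_eulerLagrange_deltaV,
    fun l hl => by
      obtain ⟨l, rfl⟩ := Nat.exists_eq_add_of_le' hl
      exact DVB.exact_deltaV,
    DVB.homotopy_one,
    fun l hl σ => by
      obtain ⟨l, rfl⟩ := Nat.exists_eq_add_of_le' hl
      exact DVB.homotopy_succ σ⟩
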